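/- Let $\|\cdot\|$ be the norm of $L^2(0,1)$, $S=H^2(0,1)\cap H^1_0(0,1)$, $\mathbb{R}_+=[0,+\infty)$ and $s^+=\max(s,0)$. Let $\bar p>0$, let $\phi\in C^\infty(\mathbb{R};\mathbb{R}_+)$, and let $K:[0,1]\times\mathbb{R}\to\mathbb{R}$ and $L:S\times\mathbb{R}\to\mathbb{R}$ satisfy $$|L(w,y)|\le\|w\|+\phi(y)|y|,\qquad |K(x,y)|\le|y|\qquad\text{for all }x\in[0,1],\ y\in\mathbb{R},\ w\in S.$$ Let $\varepsilon,\Gamma,\kappa,a,C>0$ be constants with $2\kappa>a$, and let $P_1,P_2,P_3\in C^\infty(\mathbb{R})$ satisfy, for all $y\in\mathbb{R}$, $$P_1(y)\ge\tfrac{1}{4a\kappa^6}\left(\kappa+4aC+4\kappa^3+4a\kappa\phi(y)+8a\kappa^2\right),$$ $$P_2(y)\ge\tfrac{1}{4a^3\kappa^5}\left(\tfrac{1}{16\kappa}(\kappa+4aC+4\kappa^3+4a\kappa\phi(y))^2+\kappa^2+a^2\phi^2(y)+4a^2(\kappa^3+1)\right),$$ $$P_3(y)\ge\tfrac{1}{64a^7\kappa^4}\left((\kappa^2+a^2\phi^2(y))^2+16a^4\right).$$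 Let $d,\theta_2\in L^\infty(\mathbb{R}_+)$, $\theta_1,\delta\in L^\infty(\mathbb{R}_+;L^2(0,1))$ and $b\in L^\infty(\mathbb{R}_+;(0,+\infty))$ with $\beta:=\inf_{t\ge0}b(t)>0$. (Infima, suprema, upper and lower limits and limits of these inputs are understood up to sets of times of measure zero.) Let $w\in C^0(\mathbb{R}_+;L^2(0,1))$ with $t\mapsto\|w[t]\|^2$ locally absolutely continuous and $w\in L^1((0,T);S)$ for each $T>0$, $z\in C^1(\mathbb{R}_+)$, and $y\in C^0(\mathbb{R}_+)$ locally absolutely continuous, be a solution of the closed-loop system $$w_t=\bar p\,w_{xx}+\theta_1(t,x)K(x,y(t))+\delta(t,x),\qquad w(t,0)=w(t,1)=0,$$ $$\dot y=b(t)u(t)+\theta_2(t)L(w[t],y(t))+d(t),$$ $$u=-(\kappa+e^{z})^7\left(P_1(y)+P_2(y)y^2+P_3(y)y^6\right)y,\qquad \dot z=\Gamma e^{-z}\left(\tfrac12y^2-\varepsilon\right)^+,$$ i.e. these equations hold for almost every $t\ge0$ ($w_t$ being the derivative in $L^2(0,1)$). Set $$K_1=K_2=\tfrac{1}{2\bar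 p},\quad R=\tfrac1{\bar p},\quad G=\tfrac{1}{\bar p^2(4\pi^2-5)},\quad \mu=\min\left(\tfrac{2\kappa-a}{2\kappa K_2},2C\right),\quad g(s,l)=\left((s-\kappa-e^{l})^+\right)^2,$$ $$Z=G\|\delta\|_\infty^2+\tfrac{a}{\kappa+e^{z(0)}}\left(\|d\|_\infty^2+g(\|\theta_2\|_\infty,z(0))+g^2(\|\theta_2\|_\infty,z(0))+4\beta\,g(\tfrac1\beta,z(0))+g^2(R\|\theta_1\|_\infty,z(0))\right),$$ $$B=\tfrac{1}{2K_1}\left(K_2\|w[0]\|^2+\tfrac12|y(0)|^2+\mu^{-1}Z\right)+g(\|\theta_2\|_\infty,z(0))+\|d\|_\infty^2+g^2(\|\theta_2\|_\infty,z(0))+2\beta\,g(\tfrac1\beta,z(0)).$$ Then, for all $t\ge0$, $$2K_1\|w[t]\|^2+|y(t)|^2\le e^{-\mu t}\left(2K_2\|w[0]\|^2+|y(0)|^2\right)+2\mu^{-1}Z,$$ $$z(0)\le z(t)\le\ln\left(e^{z(0)}+\tfrac{\Gamma}{4C}|y(0)|^2+aB\,\tfrac{2C(1+e^{z(0)})+\varepsilon\Gamma}{4C^2\varepsilon\min(1,\kappa)(1+e^{z(0)})}\right),$$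 and moreover $$\limsup_{t\to+\infty}\|w[t]\|\le\sqrt{\tfrac{K_2}{K_1}\left(2\varepsilon R^2\left(\limsup_{t\to+\infty}\|\theta_1[t]\|\right)^2+G\left(\limsup_{t\to+\infty}\|\delta[t]\|\right)^2\right)},\qquad \limsup_{t\to+\infty}|y(t)|\le\sqrt{2\varepsilon}.$$ Finally, $z(t)$ has a finite limit as $t\to+\infty$, and if $\lim_{t\to+\infty}d(t)=0$, $\lim_{t\to+\infty}\delta[t]=0$ and $\liminf_{t\to+\infty}b(t)\ge1/\kappa$, then $$\text{either}\quad\lim_{t\to+\infty}|y(t)|=\lim_{t\to+\infty}\|w[t]\|=0\quad\text{or}\quad \kappa+\exp\left(\lim_{s\to+\infty}z(s)\right)<\limsup_{t\to+\infty}\max\left(\bar p^{-1}\|\theta_1[t]\|,|\theta_2(t)|\right).$$ -/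

import Mathlib

open MeasureTheory Filter Topology Set
open scoped ContDiff

namespace DADS

noncomputable section

/-! ### The spaces `L²(0,1)`, `H²(0,1)`, `H₀¹(0,1)` -/

/-- The real Hilbert space `L²(0,1)`. -/
abbrev L2 : Type := Lp ℝ 2 (volume.restrict (Ioo (0 : ℝ) 1))

/-- Functions of class `C¹` with compact support in `(0,1)` (extended by zero to the line). -/
def IsTest (η : ℝ → ℝ) : Prop :=
  ContDiff ℝ 1 η ∧ HasCompactSupport η ∧ tsupport η ⊆ Ioo (0 : ℝ) 1

/-- `g ∈ L²(0,1)` is the weak derivative of `f ∈ L²(0,1)` on `(0,1)`. -/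
def IsWeakDeriv (f g : L2) : Prop :=
  ∀ η : ℝ → ℝ, IsTest η →
    ∫ x in Ioo (0 : ℝ) 1, f x * deriv η x = - ∫ x in Ioo (0 : ℝ) 1, g x * η x

/-- `H²(0,1)`, as a subset of `L²(0,1)`. -/
def H2 : Set L2 := {f | ∃ g h : L2, IsWeakDeriv f g ∧ IsWeakDeriv g h}

/-- `H₀¹(0,1)`, as a subset of `L²(0,1)`: the functions with a weak derivative in `L²(0,1)` that
are limits, in the norm of `H¹(0,1)`, of `C¹` functions with compact support in `(0,1)`. -/
def H10 : Set L2 :=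
  {f | ∃ g : L2, IsWeakDeriv f g ∧ ∀ r : ℝ, 0 < r → ∃ η : ℝ → ℝ, IsTest η ∧
    eLpNorm (fun x => f x - η x) 2 (volume.restrict (Ioo (0 : ℝ) 1)) < ENNReal.ofReal r ∧
    eLpNorm (fun x => g x - deriv η x) 2 (volume.restrict (Ioo (0 : ℝ) 1)) < ENNReal.ofReal r}

/-- The space `S = H²(0,1) ∩ H₀¹(0,1)`. -/
def S : Set L2 := H2 ∩ H10

/-- `w ∈ L¹((0,T); H²(0,1) ∩ H₀¹(0,1))`, the space `H²(0,1) ∩ H₀¹(0,1)` carrying the norm of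
`H²(0,1)`: as `H²(0,1)` embeds in `L²(0,1)³` as a closed subspace through
`f ↦ (f, f_x, f_xx)`, this means that `w`, `w_x` and `w_xx` are Bochner integrable on `(0,T)` with
values in `L²(0,1)`. -/
def MemL1S (w : ℝ → L2) (T : ℝ) : Prop :=
  ∃ wx wxx : ℝ → L2,
    (∀ᵐ t ∂(volume.restrict (Ioo (0 : ℝ) T)),
      w t ∈ S ∧ IsWeakDeriv (w t) (wx t) ∧ IsWeakDeriv (wx t) (wxx t)) ∧
    IntegrableOn w (Ioo 0 T) ∧ IntegrableOn wx (Ioo 0 T) ∧ IntegrableOn wxx (Ioo 0 T)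

/-! ### Inputs on `ℝ₊ = [0,∞)` -/

/-- Lebesgue measure on `ℝ₊`. -/
def halfLine : Measure ℝ := volume.restrict (Ici (0 : ℝ))

/-- `f ∈ L^∞(ℝ₊; E)`. -/
def MemLinf {E : Type*} [NormedAddCommGroup E] (f : ℝ → E) : Prop := MemLp f ⊤ halfLine

/-- The norm of `L^∞(ℝ₊; E)`. -/
def normInf {E : Type*} [NormedAddCommGroup E] (f : ℝ → E) : ℝ := (eLpNorm f ⊤ halfLine).toReal

/-- The filter of limits `t → +∞` up to sets of times of measure zero: limits, upper limits and
lower limits of elements of `L^∞(ℝ₊; E)` are taken along it, so that they do not depend on the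
representative. -/
def atTopAE : Filter ℝ := atTop ⊓ ae volume

/-- Local absolute continuity on `ℝ₊`. -/
def LocAC (f : ℝ → ℝ) : Prop := ∀ T : ℝ, 0 < T → AbsolutelyContinuousOnInterval f 0 T

/-! ### The controller -/

/-- The feedback law `u = -(κ + exp z)⁷ (P₁(y) + P₂(y) y² + P₃(y) y⁶) y`. -/
def feedback (κ : ℝ) (P₁ P₂ P₃ : ℝ → ℝ) (z y : ℝ) : ℝ :=
  -((κ + Real.exp z) ^ 7 * (P₁ y + P₂ y * y ^ 2 + P₃ y * y ^ 6) * y)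

/-- The update law `ż = Γ exp(-z) (y²/2 - ε)⁺`: its right-hand side. -/
def updateLaw (ε Γ z y : ℝ) : ℝ := Γ * Real.exp (-z) * max (y ^ 2 / 2 - ε) 0

/-- The smooth gains `P₁, P₂, P₃` are admissible for the controller parameters `κ, a, C` and the
growth function `φ`. -/
structure AdmissibleGains (κ a C : ℝ) (φ P₁ P₂ P₃ : ℝ → ℝ) : Prop where
  smooth₁ : ContDiff ℝ ∞ P₁
  smooth₂ : ContDiff ℝ ∞ P₂
  smooth₃ : ContDiff ℝ ∞ P₃
  ge₁ : ∀ y : ℝ, 1 / (4 * a * κ ^ 6) *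
      (κ + 4 * a * C + 4 * κ ^ 3 + 4 * a * κ * φ y + 8 * a * κ ^ 2) ≤ P₁ y
  ge₂ : ∀ y : ℝ, 1 / (4 * a ^ 3 * κ ^ 5) *
      (1 / (16 * κ) * (κ + 4 * a * C + 4 * κ ^ 3 + 4 * a * κ * φ y) ^ 2
        + κ ^ 2 + a ^ 2 * φ y ^ 2 + 4 * a ^ 2 * (κ ^ 3 + 1)) ≤ P₂ y
  ge₃ : ∀ y : ℝ, 1 / (64 * a ^ 7 * κ ^ 4) *
      ((κ ^ 2 + a ^ 2 * φ y ^ 2) ^ 2 + 16 * a ^ 4) ≤ P₃ y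

/-! ### The closed-loop system -/

/-- `(w, y, z)` is a solution on `ℝ₊`, in the regularity class considered, of the heat equation
`w_t = p w_xx + θ₁ K(x,y) + δ`, `w(t,0) = w(t,1) = 0`, coupled with `ẏ = b u + θ₂ L(w,y) + d` and
closed with the controller. All equations hold for almost every `t ≥ 0`; the time derivative
of `w` is the derivative in the norm of `L²(0,1)`, and the Dirichlet conditions are expressed by
`w[t] ∈ H₀¹(0,1)`. -/
structure IsClosedLoopSolution (p : ℝ) (K : ℝ → ℝ → ℝ) (L : S → ℝ → ℝ)
    (ε Γ κ : ℝ) (P₁ P₂ P₃ : ℝ → ℝ)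
    (d θ₂ b : ℝ → ℝ) (θ₁ δ : ℝ → L2) (w : ℝ → L2) (y z : ℝ → ℝ) : Prop where
  w_cont : ContinuousOn w (Ici 0)
  w_ac : LocAC (fun t => ‖w t‖ ^ 2)
  w_int : ∀ T : ℝ, 0 < T → MemL1S w T
  z_C1 : ContDiffOn ℝ 1 z (Ici 0)
  y_cont : ContinuousOn y (Ici 0)
  y_ac : LocAC y
  heat : ∀ᵐ t ∂halfLine, ∃ wx wxx wt : L2,
    IsWeakDeriv (w t) wx ∧ IsWeakDeriv wx wxx ∧ HasDerivAt w wt t ∧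
    ∀ᵐ x ∂(volume.restrict (Ioo (0 : ℝ) 1)),
      wt x = p * wxx x + θ₁ t x * K x (y t) + δ t x
  y_eq : ∀ᵐ t ∂halfLine, ∃ h : w t ∈ S,
    HasDerivAt y (b t * feedback κ P₁ P₂ P₃ (z t) (y t) + θ₂ t * L ⟨w t, h⟩ (y t) + d t) t
  z_eq : ∀ᵐ t ∂halfLine, HasDerivAt z (updateLaw ε Γ (z t) (y t)) t

/-! ### The constants of the estimates -/

/-- `g(s,l) = ((s - κ - exp l)⁺)²`. -/
def g (κ s l : ℝ) : ℝ := (max (s - κ - Real.exp l) 0) ^ 2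

/-- The decay rate `μ = min ((2κ - a)/(2κ K₂), 2C)`. -/
def rate (K₂ κ a C : ℝ) : ℝ := min ((2 * κ - a) / (2 * κ * K₂)) (2 * C)

/-- The constant `Z`; `nδ, nd, nθ₁, nθ₂` are the `L^∞` norms of the inputs, `β` is the infimum
of `b` and `z₀ = z(0)`. -/
def constZ (G R κ a nδ nd nθ₁ nθ₂ β z₀ : ℝ) : ℝ :=
  G * nδ ^ 2
    + a / (κ + Real.exp z₀) * (nd ^ 2 + g κ nθ₂ z₀ + (g κ nθ₂ z₀) ^ 2)
    + a / (κ + Real.exp z₀) * (4 * β * g κ (1 / β) z₀ + (g κ (R * nθ₁) z₀) ^ 2)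

/-- The constant `B`; `w₀` is the norm of `w[0]` and `y₀ = y(0)`. -/
def constB (K₁ K₂ κ μ Z w₀ y₀ nd nθ₂ β z₀ : ℝ) : ℝ :=
  1 / (2 * K₁) * (K₂ * w₀ ^ 2 + 1 / 2 * |y₀| ^ 2 + μ⁻¹ * Z) + g κ nθ₂ z₀
    + nd ^ 2 + (g κ nθ₂ z₀) ^ 2 + 2 * β * g κ (1 / β) z₀

end

end DADS

open DADS

namespace DADS

/-! ### Differential inequalities for absolutely continuous functions -/

/-! The proof is a Lyapunov argument for V = K₂‖w‖² + y²/2 with the adapted gain s = κ + exp z.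
Pairing the heat equation with w and using the sharp Poincaré constant π² gives dissipation -‖w‖² at
the cost of (R‖θ₁‖)²y² (`heat_term_le`). In the y-equation each unknown coefficient n is split as n
≤ s + (n - s)⁺. The part with s is a polynomial in y that the feedback dominates
(`AdmissibleGains.dominates`), and Young's inequality puts the factor a/s in front of every term
containing the excess (n - s)⁺. The unknown control coefficient b is treated likewise, through its
deficit (1/b - s)⁺ (`le_mul_add_of_gain`). Hence V' ≤ -μV + h(t), where h is `constZ` at the current
inputs. As z never decreases, h ≤ Z, which gives the exponential estimate.

The gain stays bounded because it attenuates its own forcing. With ζ = exp z and v = y²/2, one has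
ζ' = Γ(v - ε)⁺ and v' ≤ -2Cv + M/(1 + ζ). Once ζ reaches M/(2Cε), the excess of v over ε decays
exponentially and has a finite integral (`gain_le`). So z converges, and a one-sided Barbalat
argument (`eventually_le_of_gain_tendsto`) gives limsup y²/2 ≤ ε; the heat estimate turns this into
the bound on limsup ‖w‖.

For the final alternative, if the limiting gain is at least the upper limit of the uncertain inputs,
every excess tends to 0. Then h → 0 when d and δ vanish in the limit and liminf b ≥ 1/κ, so V → 0.
-/

theorem _root_.AbsolutelyContinuousOnInterval.le_of_ae_deriv_nonpos {f : ℝ → ℝ} {s t : ℝ}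
    (hst : s ≤ t) (hf : AbsolutelyContinuousOnInterval f s t)
    (h : ∀ᵐ x, x ∈ Ioo s t → ∃ f', HasDerivAt f f' x ∧ f' ≤ 0) : f t ≤ f s := by
  have h1 := hf.integral_deriv_eq_sub
  have h2 : ∫ x in s..t, deriv f x ≤ ∫ _ in s..t, (0 : ℝ) := by
    rw [intervalIntegral.integral_of_le hst, intervalIntegral.integral_of_le hst,
      integral_Ioc_eq_integral_Ioo, integral_Ioc_eq_integral_Ioo]
    refine integral_mono_ae ?_ (integrable_zero _ _ _) ?_
    · exact ((intervalIntegrable_iff_integrableOn_Ioc_of_le hst).1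
        hf.intervalIntegrable_deriv).mono_set Ioo_subset_Ioc_self
    · refine (ae_restrict_iff' measurableSet_Ioo).2 ?_
      filter_upwards [h] with x hx hxm
      obtain ⟨f', hf', hle⟩ := hx hxm
      simpa [hf'.deriv] using hle
  simp only [intervalIntegral.integral_zero] at h2
  linarith

theorem _root_.ContDiff.absolutelyContinuousOnInterval {f : ℝ → ℝ} (hf : ContDiff ℝ 1 f)
    (s t : ℝ) : AbsolutelyContinuousOnInterval f s t :=
  hf.contDiffOn.absolutelyContinuousOnInterval

/-- Integrating factor: exp(c(x - s)) (f x - M/c) is absolutely continuous with nonpositive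
derivative almost everywhere. -/
theorem _root_.AbsolutelyContinuousOnInterval.le_exp_of_ae_deriv_le {f : ℝ → ℝ} {s t c M : ℝ}
    (hst : s ≤ t) (hc : 0 < c) (hf : AbsolutelyContinuousOnInterval f s t)
    (h : ∀ᵐ x, x ∈ Ioo s t → ∃ f', HasDerivAt f f' x ∧ f' ≤ -c * f x + M) :
    f t - M / c ≤ Real.exp (-c * (t - s)) * (f s - M / c) := by
  have hE : ContDiff ℝ 1 (fun x => Real.exp (c * (x - s))) := by fun_prop
  have hac : AbsolutelyContinuousOnInterval
      (fun x => Real.exp (c * (x - s)) * (f x - M / c)) s t :=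
    (hE.absolutelyContinuousOnInterval s t).fun_mul
      (hf.fun_sub ((contDiff_const (c := M / c)).absolutelyContinuousOnInterval s t))
  have key := hac.le_of_ae_deriv_nonpos hst (by
    filter_upwards [h] with x hx hxm
    obtain ⟨f', hf', hle⟩ := hx hxm
    have hd : HasDerivAt (fun x => Real.exp (c * (x - s))) (Real.exp (c * (x - s)) * c) x := by
      have := (((hasDerivAt_id x).sub_const s).const_mul c).exp
      simpa using this
    refine ⟨_, hd.mul (hf'.sub_const _), ?_⟩
    have : Real.exp (c * (x - s)) * c * (f x - M / c) + Real.exp (c * (x - s)) * f'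
        = Real.exp (c * (x - s)) * (c * f x - M + f') := by
      field_simp
    rw [this]
    exact mul_nonpos_of_nonneg_of_nonpos (Real.exp_pos _).le (by linarith))
  simp only [sub_self, mul_zero, Real.exp_zero, one_mul] at key
  have h3 : Real.exp (-c * (t - s)) * Real.exp (c * (t - s)) = 1 := by
    rw [← Real.exp_add]; simp
  calc f t - M / c = Real.exp (-c * (t - s)) * (Real.exp (c * (t - s)) * (f t - M / c)) := by
        rw [← mul_assoc, h3, one_mul]
    _ ≤ _ := mul_le_mul_of_nonneg_left key (Real.exp_pos _).le

theorem LocAC.mono {f : ℝ → ℝ} (hf : LocAC f) {s t : ℝ} (hs : 0 ≤ s) (hst : s ≤ t) :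
    AbsolutelyContinuousOnInterval f s t := by
  refine (hf (t + 1) (by linarith)).mono ?_
  rw [uIcc_of_le hst, uIcc_of_le (by linarith)]
  exact Icc_subset_Icc hs (by linarith)

theorem LocAC.add {f g : ℝ → ℝ} (hf : LocAC f) (hg : LocAC g) : LocAC (fun t => f t + g t) :=
  fun T hT => (hf T hT).fun_add (hg T hT)

theorem LocAC.const_mul {f : ℝ → ℝ} (c : ℝ) (hf : LocAC f) : LocAC (fun t => c * f t) :=
  fun T hT => (hf T hT).const_mul c

theorem LocAC.sq {f : ℝ → ℝ} (hf : LocAC f) : LocAC (fun t => f t ^ 2) := by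
  intro T hT
  simpa [pow_two] using (hf T hT).fun_mul (hf T hT)

theorem LocAC.of_contDiffOn {f : ℝ → ℝ} (hf : ContDiffOn ℝ 1 f (Ici 0)) : LocAC f := by
  intro T hT
  refine (hf.mono ?_).absolutelyContinuousOnInterval
  rw [uIcc_of_le hT.le]
  exact Icc_subset_Ici_self

theorem ae_halfLine_iff {P : ℝ → Prop} : (∀ᵐ t ∂halfLine, P t) ↔ ∀ᵐ t, 0 ≤ t → P t :=
  ae_restrict_iff' measurableSet_Ici

theorem eventually_atTopAE_iff {P : ℝ → Prop} :
    (∀ᶠ t in atTopAE, P t) ↔ ∃ T : ℝ, ∀ᵐ t, T ≤ t → P t := by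
  constructor
  · intro h
    obtain ⟨u, hu, v, hv, huv⟩ := mem_inf_iff_superset.1 h
    obtain ⟨T, hT⟩ := mem_atTop_sets.1 hu
    refine ⟨T, ?_⟩
    filter_upwards [hv] with t ht hTt
    exact huv ⟨hT t hTt, ht⟩
  · rintro ⟨T, hT⟩
    filter_upwards [mem_inf_of_left (Ici_mem_atTop T), mem_inf_of_right hT] with t h1 h2
    exact h2 h1

theorem eventually_atTopAE_of_halfLine {P : ℝ → Prop} (h : ∀ᵐ t ∂halfLine, P t) :
    ∀ᶠ t in atTopAE, P t :=
  eventually_atTopAE_iff.2 ⟨0, ae_halfLine_iff.1 h⟩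

theorem eventually_atTopAE_of_atTop {P : ℝ → Prop} (h : ∀ᶠ t in atTop, P t) :
    ∀ᶠ t in atTopAE, P t := h.filter_mono inf_le_left

instance atTopAE_neBot : NeBot atTopAE := by
  refine ⟨fun h => ?_⟩
  have : ∀ᶠ _ in atTopAE, False := by rw [h]; exact eventually_bot
  obtain ⟨T, hT⟩ := eventually_atTopAE_iff.1 this
  have h0 : volume (Ici T) = 0 := by
    refine measure_mono_null ?_ (ae_iff.1 hT)
    intro t ht
    simpa using ht
  simp at h0

/-- A scalar differential inequality `f' ≤ -c f + h` with `h ≤ M` eventually gives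
`limsup f ≤ M / c`. -/
theorem LocAC.eventually_le_of_ae_deriv_le {f h : ℝ → ℝ} {c M : ℝ} (hf : LocAC f) (hc : 0 < c)
    (hd : ∀ᵐ t ∂halfLine, ∃ f', HasDerivAt f f' t ∧ f' ≤ -c * f t + h t)
    (hh : ∀ᶠ t in atTopAE, h t ≤ M) {r : ℝ} (hr : 0 < r) :
    ∀ᶠ t in atTop, f t ≤ M / c + r := by
  obtain ⟨T, hT⟩ := eventually_atTopAE_iff.1 (hh.and (eventually_atTopAE_of_halfLine hd))
  set s := max T 0
  have hlim : Tendsto (fun t => Real.exp (-c * (t - s)) * (f s - M / c)) atTop (𝓝 0) := by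
    have h1 : Tendsto (fun t : ℝ => -c * (t - s)) atTop atBot :=
      (tendsto_atTop_add_const_right _ _ tendsto_id).const_mul_atTop_of_neg (by linarith)
    simpa using (Real.tendsto_exp_atBot.comp h1).mul_const (f s - M / c)
  filter_upwards [hlim.eventually_lt_const hr, eventually_ge_atTop s] with t ht hst
  have := (hf.mono (le_max_right T 0) hst).le_exp_of_ae_deriv_le hst hc (M := M) (by
    filter_upwards [hT] with x hx hxm
    obtain ⟨h1, f', h2, h3⟩ := hx ((le_max_left T 0).trans hxm.1.le)
    exact ⟨f', h2, by linarith⟩)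
  linarith

/-! ### The Poincaré inequality on `H²(0,1) ∩ H₀¹(0,1)` -/

theorem IsTest.eq_zero_of_notMem {η : ℝ → ℝ} (hη : IsTest η) {x : ℝ} (hx : x ∉ Ioo (0 : ℝ) 1) :
    η x = 0 :=
  image_eq_zero_of_notMem_tsupport fun h => hx (hη.2.2 h)

theorem IsTest.continuous_deriv {η : ℝ → ℝ} (hη : IsTest η) : Continuous (deriv η) :=
  hη.1.continuous_deriv le_rfl

theorem IsTest.memLp {η : ℝ → ℝ} (hη : IsTest η) :
    MemLp η 2 (volume.restrict (Ioo (0 : ℝ) 1)) :=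
  (hη.1.continuous.memLp_of_hasCompactSupport hη.2.1).restrict _

theorem IsTest.memLp_deriv {η : ℝ → ℝ} (hη : IsTest η) :
    MemLp (deriv η) 2 (volume.restrict (Ioo (0 : ℝ) 1)) :=
  (hη.continuous_deriv.memLp_of_hasCompactSupport hη.2.1.deriv).restrict _

/-- The factor c may be singular at the endpoints: off the closed support of η the product vanishes
locally. This admits the cotangent in the proof of the Poincaré inequality. -/
theorem IsTest.contDiff_mul {η c : ℝ → ℝ} (hη : IsTest η)
    (hc : ∀ x ∈ Ioo (0 : ℝ) 1, ContDiffAt ℝ 1 c x) : ContDiff ℝ 1 (fun x => c x * η x) := by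
  refine contDiff_iff_contDiffAt.2 fun x => ?_
  by_cases hx : x ∈ tsupport η
  · exact (hc x (hη.2.2 hx)).mul hη.1.contDiffAt
  · have h0 : (fun x => c x * η x) =ᶠ[𝓝 x] fun _ => 0 := by
      filter_upwards [notMem_tsupport_iff_eventuallyEq.1 hx] with y hy
      simp [hy]
    exact contDiffAt_const.congr_of_eventuallyEq h0

theorem setIntegral_Ioo_deriv_eq_sub {F : ℝ → ℝ} (hF : ContDiff ℝ 1 F) :
    ∫ x in Ioo (0 : ℝ) 1, deriv F x = F 1 - F 0 := by
  rw [← integral_Ioc_eq_integral_Ioo, ← intervalIntegral.integral_of_le zero_le_one]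
  exact intervalIntegral.integral_deriv_eq_sub
    (fun x _ => (hF.differentiable (by norm_num)).differentiableAt)
    ((hF.continuous_deriv le_rfl).intervalIntegrable _ _)

theorem _root_.Continuous.integrableOn_Ioo_zero_one {f : ℝ → ℝ} (hf : Continuous f) :
    IntegrableOn f (Ioo (0 : ℝ) 1) :=
  hf.integrableOn_Icc.mono_set Ioo_subset_Icc_self

/-- The sharp Poincaré inequality for test functions. -/
theorem IsTest.poincare {η : ℝ → ℝ} (hη : IsTest η) :
    Real.pi ^ 2 * ∫ x in Ioo (0 : ℝ) 1, η x ^ 2 ≤ ∫ x in Ioo (0 : ℝ) 1, deriv η x ^ 2 := by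
  -- Logarithmic derivative of the first Dirichlet eigenfunction sin(πx). It solves the Riccati
  -- equation c' = -π² - c², so (cη²)' = η'² - π²η² - (η' - cη)², and the integral of the left side
  -- is zero.
  set c : ℝ → ℝ := fun x => Real.pi * Real.cos (Real.pi * x) / Real.sin (Real.pi * x)
  have hsin : ∀ x ∈ Ioo (0 : ℝ) 1, Real.sin (Real.pi * x) ≠ 0 := fun x hx =>
    (Real.sin_pos_of_pos_of_lt_pi (mul_pos Real.pi_pos hx.1)
      (by nlinarith [Real.pi_pos, hx.2])).ne'
  have hc : ∀ x ∈ Ioo (0 : ℝ) 1, ContDiffAt ℝ 1 c x := fun x hx => by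
    refine ContDiffAt.div ?_ ?_ (hsin x hx) <;> fun_prop
  have hq := hη.contDiff_mul hc
  have hF : ContDiff ℝ 1 (fun x => (c x * η x) * η x) := hq.mul hη.1
  have hF0 := setIntegral_Ioo_deriv_eq_sub hF
  rw [hη.eq_zero_of_notMem (x := 0) (by simp), hη.eq_zero_of_notMem (x := 1) (by simp)] at hF0
  have hpt : ∀ x ∈ Ioo (0 : ℝ) 1, deriv (fun x => (c x * η x) * η x) x
      ≤ deriv η x ^ 2 - Real.pi ^ 2 * η x ^ 2 := by
    intro x hx
    have hs := hsin x hx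
    have h1 : HasDerivAt η (deriv η x) x :=
      (hη.1.differentiable (by norm_num)).differentiableAt.hasDerivAt
    have hl : HasDerivAt (fun x : ℝ => Real.pi * x) Real.pi x := by
      simpa using (hasDerivAt_id x).const_mul Real.pi
    have h2 : HasDerivAt c (-Real.pi ^ 2 - c x ^ 2) x := by
      have := (hl.cos.const_mul Real.pi).div hl.sin hs
      convert! this using 1
      simp only [c]
      field_simp
    have h3 : deriv (fun x => (c x * η x) * η x) x = _ := ((h2.mul h1).mul h1).deriv
    rw [h3]
    simp only [Pi.mul_apply]
    nlinarith [sq_nonneg (deriv η x - c x * η x)]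
  have i1 : IntegrableOn (fun x => deriv η x ^ 2) (Ioo (0 : ℝ) 1) :=
    (hη.continuous_deriv.pow 2).integrableOn_Ioo_zero_one
  have i2 : IntegrableOn (fun x => Real.pi ^ 2 * η x ^ 2) (Ioo (0 : ℝ) 1) :=
    (continuous_const.mul (hη.1.continuous.pow 2)).integrableOn_Ioo_zero_one
  have hle := setIntegral_mono_on (hF.continuous_deriv le_rfl).integrableOn_Ioo_zero_one
    (i1.sub i2) measurableSet_Ioo hpt
  rw [hF0] at hle
  simp only [Pi.sub_apply] at hle
  rw [integral_sub i1 i2, integral_const_mul] at hle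
  linarith

theorem norm_toLp_sq {f : ℝ → ℝ} (hf : MemLp f 2 (volume.restrict (Ioo (0 : ℝ) 1))) :
    ‖hf.toLp f‖ ^ 2 = ∫ x in Ioo (0 : ℝ) 1, f x ^ 2 := by
  rw [← real_inner_self_eq_norm_sq, L2.inner_def]
  refine integral_congr_ae ?_
  filter_upwards [hf.coeFn_toLp] with x hx
  simp [hx, pow_two]

theorem inner_toLp {f : ℝ → ℝ} (u : L2) (hf : MemLp f 2 (volume.restrict (Ioo (0 : ℝ) 1))) :
    inner ℝ u (hf.toLp f) = ∫ x in Ioo (0 : ℝ) 1, u x * f x := by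
  rw [L2.inner_def]
  refine integral_congr_ae ?_
  filter_upwards [hf.coeFn_toLp] with x hx
  simp [hx, mul_comm]

theorem IsWeakDeriv.inner_eq {u v : L2} (h : IsWeakDeriv u v) {η : ℝ → ℝ} (hη : IsTest η) :
    inner ℝ u (hη.memLp_deriv.toLp (deriv η)) = - inner ℝ v (hη.memLp.toLp η) := by
  rw [inner_toLp, inner_toLp, h η hη]

/-- Fundamental lemma of the calculus of variations; smooth compactly supported functions are among
the C¹ test functions. -/
theorem IsWeakDeriv.unique {u v v' : L2} (h : IsWeakDeriv u v) (h' : IsWeakDeriv u v') :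
    v = v' := by
  have hint : LocallyIntegrableOn (fun x => v x - v' x) (Ioo (0 : ℝ) 1) volume := by
    have : IntegrableOn (fun x => v x - v' x) (Ioo (0 : ℝ) 1) volume :=
      ((Lp.memLp v).integrable (by norm_num)).sub ((Lp.memLp v').integrable (by norm_num))
    exact this.locallyIntegrableOn
  have key := isOpen_Ioo.ae_eq_zero_of_integral_contDiff_smul_eq_zero hint (fun η h1 h2 h3 => by
    have hη : IsTest η := ⟨h1.of_le (by exact_mod_cast le_top), h2, h3⟩
    have e := (h η hη).symm.trans (h' η hη)
    rw [← inner_toLp v hη.memLp, ← inner_toLp v' hη.memLp] at e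
    have e2 : inner ℝ (v - v') (hη.memLp.toLp η) = 0 := by
      rw [inner_sub_left]; linarith
    rw [inner_toLp] at e2
    rw [← setIntegral_eq_integral_of_forall_compl_eq_zero (s := Ioo (0 : ℝ) 1)
      (fun x hx => by simp [hη.eq_zero_of_notMem hx])]
    refine Eq.trans (integral_congr_ae ?_) e2
    filter_upwards [Lp.coeFn_sub v v'] with x hx
    rw [hx, smul_eq_mul, mul_comm, Pi.sub_apply])
  refine Lp.ext ?_
  refine (ae_restrict_iff' measurableSet_Ioo).2 ?_
  filter_upwards [key] with x hx hxm
  linarith [hx hxm]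

theorem dist_toLp_lt {u : L2} {f : ℝ → ℝ} (hf : MemLp f 2 (volume.restrict (Ioo (0 : ℝ) 1)))
    {r : ℝ}
    (h : eLpNorm (fun x => u x - f x) 2 (volume.restrict (Ioo (0 : ℝ) 1)) < ENNReal.ofReal r) :
    dist (hf.toLp f) u < r := by
  rw [dist_comm, Lp.dist_def]
  have : eLpNorm (⇑u - ⇑(hf.toLp f)) 2 (volume.restrict (Ioo (0 : ℝ) 1))
      = eLpNorm (fun x => u x - f x) 2 (volume.restrict (Ioo (0 : ℝ) 1)) := by
    refine eLpNorm_congr_ae ?_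
    filter_upwards [hf.coeFn_toLp] with x hx
    simp [hx]
  rw [this]
  exact (ENNReal.lt_ofReal_iff_toReal_lt h.ne_top).1 h

theorem tendsto_of_dist_lt {X : Type*} [PseudoMetricSpace X] {u : ℕ → X} {x : X}
    (h : ∀ n, dist (u n) x < 1 / ((n : ℝ) + 1)) : Tendsto u atTop (𝓝 x) :=
  tendsto_iff_dist_tendsto_zero.2 (squeeze_zero (fun _ => dist_nonneg) (fun n => (h n).le)
    tendsto_one_div_add_atTop_nhds_zero_nat)

/-- Integration by parts and the sharp Poincaré inequality on `H²(0,1) ∩ H₀¹(0,1)`. -/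
theorem inner_weakDeriv_weakDeriv_le {u v s : L2} (hu : u ∈ H10) (huv : IsWeakDeriv u v)
    (hvs : IsWeakDeriv v s) : inner ℝ u s ≤ - (Real.pi ^ 2 * ‖u‖ ^ 2) := by
  obtain ⟨v', hv', happ⟩ := hu
  obtain rfl := huv.unique hv'
  choose η hη h1 h2 using fun n : ℕ => happ (1 / ((n : ℝ) + 1)) Nat.one_div_pos_of_nat
  have t1 : Tendsto (fun n => (hη n).memLp.toLp (η n)) atTop (𝓝 u) :=
    tendsto_of_dist_lt fun n => dist_toLp_lt _ (h1 n)
  have t2 : Tendsto (fun n => (hη n).memLp_deriv.toLp (deriv (η n))) atTop (𝓝 v) :=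
    tendsto_of_dist_lt fun n => dist_toLp_lt _ (h2 n)
  -- No boundary term arises: the weak derivative relation between v and s is tested with the
  -- approximants η n of u, whose derivatives tend to v.
  have e1 : inner ℝ v v = - inner ℝ s u :=
    tendsto_nhds_unique ((tendsto_const_nhds (x := v)).inner t2)
      (((tendsto_const_nhds (x := s)).inner t1).neg.congr fun n => (hvs.inner_eq (hη n)).symm)
  have e2 : Real.pi ^ 2 * ‖u‖ ^ 2 ≤ ‖v‖ ^ 2 :=
    le_of_tendsto_of_tendsto' ((t1.norm.pow 2).const_mul _) (t2.norm.pow 2) fun n => by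
      rw [norm_toLp_sq, norm_toLp_sq]
      exact (hη n).poincare
  rw [real_inner_self_eq_norm_sq] at e1
  rw [real_inner_comm]
  linarith

/-! ### The control gain dominates the worst-case terms -/

/-- The coefficient of `y²` to be dominated in the estimate of `y²/2`, at the gain `s = κ + exp z`
and for the value `f = φ(y)`. -/
noncomputable def quadCoeff (a C f s : ℝ) : ℝ := s / (4 * a) + C + s ^ 3 / a + s * f

/-- The coefficient of `y⁴` to be dominated in the estimate of `y²/2`. -/
noncomputable def quartCoeff (a f s : ℝ) : ℝ := s ^ 3 / (4 * a ^ 3) + s * f ^ 2 / (4 * a)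

theorem quadCoeff_nonneg {a C f s : ℝ} (ha : 0 < a) (hC : 0 < C) (hf : 0 ≤ f) (hs : 0 < s) :
    0 ≤ quadCoeff a C f s := by unfold quadCoeff; positivity

theorem quartCoeff_nonneg {a f s : ℝ} (ha : 0 < a) (hs : 0 < s) :
    0 ≤ quartCoeff a f s := by unfold quartCoeff; positivity

/-- The coefficient has degree at most 3 in the gain. The exponent 3 is what matters: its square is
absorbed by the factor s⁶ in `AdmissibleGains.dominates`. -/
theorem quadCoeff_mul_le {a C f κ ρ : ℝ} (ha : 0 < a) (hC : 0 < C) (hf : 0 ≤ f) (hκ : 0 < κ)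
    (hρ : 1 ≤ ρ) : quadCoeff a C f (ρ * κ) ≤ ρ ^ 3 * quadCoeff a C f κ := by
  have h1 : ρ ≤ ρ ^ 3 := le_self_pow₀ hρ (by norm_num)
  have h2 : 1 ≤ ρ ^ 3 := one_le_pow₀ hρ
  unfold quadCoeff
  have e1 : ρ * (κ / (4 * a)) ≤ ρ ^ 3 * (κ / (4 * a)) := by gcongr
  have e2 : 1 * C ≤ ρ ^ 3 * C := by gcongr
  have e3 : ρ * (κ * f) ≤ ρ ^ 3 * (κ * f) := by gcongr
  calc _ = ρ * (κ / (4 * a)) + 1 * C + ρ ^ 3 * (κ ^ 3 / a) + ρ * (κ * f) := by ring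
    _ ≤ ρ ^ 3 * (κ / (4 * a)) + ρ ^ 3 * C + ρ ^ 3 * (κ ^ 3 / a) + ρ ^ 3 * (κ * f) := by gcongr
    _ = _ := by ring

theorem quartCoeff_mul_le {a f κ ρ : ℝ} (ha : 0 < a) (hκ : 0 < κ) (hρ : 1 ≤ ρ) :
    quartCoeff a f (ρ * κ) ≤ ρ ^ 3 * quartCoeff a f κ := by
  have h1 : ρ ≤ ρ ^ 3 := le_self_pow₀ hρ (by norm_num)
  unfold quartCoeff
  have e3 : ρ * (κ * f ^ 2 / (4 * a)) ≤ ρ ^ 3 * (κ * f ^ 2 / (4 * a)) := by gcongr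
  calc _ = ρ ^ 3 * (κ ^ 3 / (4 * a ^ 3)) + ρ * (κ * f ^ 2 / (4 * a)) := by ring
    _ ≤ ρ ^ 3 * (κ ^ 3 / (4 * a ^ 3)) + ρ ^ 3 * (κ * f ^ 2 / (4 * a)) := by gcongr
    _ = _ := by ring

/-- Writing s = ρκ with ρ ≥ 1, each coefficient on the left grows at most like ρ⁶, so the comparison
reduces to s = κ. There the lower bounds on P₁, P₂, P₃ are exactly the coefficients of y², y⁴ and y⁸
divided by κ⁶. The squares are included to compensate for the unknown b in `le_mul_add_of_gain`. -/
theorem AdmissibleGains.dominates {κ a C : ℝ} {φ P₁ P₂ P₃ : ℝ → ℝ}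
    (hP : AdmissibleGains κ a C φ P₁ P₂ P₃) (hκ : 0 < κ) (ha : 0 < a) (hC : 0 < C)
    (hφ : ∀ y, 0 ≤ φ y) {s : ℝ} (hs : κ ≤ s) (y : ℝ) :
    quadCoeff a C (φ y) s * y ^ 2 + quartCoeff a (φ y) s * y ^ 4 + 2 * s ^ 2 * y ^ 2
      + s / a * y ^ 4
      + 1 / (4 * a) * ((quadCoeff a C (φ y) s * y ^ 2) ^ 2 + (quartCoeff a (φ y) s * y ^ 4) ^ 2
        + (2 * s ^ 2 * y ^ 2) ^ 2 + (s / a * y ^ 4) ^ 2)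
      ≤ s ^ 6 * (P₁ y + P₂ y * y ^ 2 + P₃ y * y ^ 6) * y ^ 2 := by
  obtain ⟨ρ, hρ, rfl⟩ : ∃ ρ : ℝ, 1 ≤ ρ ∧ s = ρ * κ :=
    ⟨s / κ, (one_le_div hκ).2 hs, by field_simp⟩
  have h1 := hP.ge₁ y
  have h2 := hP.ge₂ y
  have h3 := hP.ge₃ y
  set f := φ y
  have hf : 0 ≤ f := hφ y
  set α := quadCoeff a C f κ with hα
  set γ := quartCoeff a f κ with hγ
  have hα0 : 0 ≤ α := quadCoeff_nonneg ha hC hf hκ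
  have hγ0 : 0 ≤ γ := quartCoeff_nonneg ha hκ
  have e1 : (α + 2 * κ ^ 2) / κ ^ 6 ≤ P₁ y := by
    refine le_trans (le_of_eq ?_) h1
    rw [hα, quadCoeff]; field_simp; ring
  have e2 : (γ + κ / a + 1 / (4 * a) * (α ^ 2 + 4 * κ ^ 4)) / κ ^ 6 ≤ P₂ y := by
    refine le_trans (le_of_eq ?_) h2
    rw [hα, hγ, quadCoeff, quartCoeff]; field_simp; ring
  have e3 : (1 / (4 * a) * (γ ^ 2 + κ ^ 2 / a ^ 2)) / κ ^ 6 ≤ P₃ y := by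
    refine le_trans (le_of_eq ?_) h3
    rw [hγ, quartCoeff]; field_simp; ring
  have hα' : quadCoeff a C f (ρ * κ) ≤ ρ ^ 3 * α := quadCoeff_mul_le ha hC hf hκ hρ
  have hγ' : quartCoeff a f (ρ * κ) ≤ ρ ^ 3 * γ := quartCoeff_mul_le ha hκ hρ
  have hρ0 : 0 < ρ := by linarith
  have hα'0 := quadCoeff_nonneg ha hC hf (mul_pos hρ0 hκ)
  have hγ'0 := quartCoeff_nonneg (f := f) ha (mul_pos hρ0 hκ)
  have p1 : ρ ≤ ρ ^ 6 := le_self_pow₀ hρ (by norm_num)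
  have p2 : ρ ^ 2 ≤ ρ ^ 6 := pow_le_pow_right₀ hρ (by norm_num)
  have p3 : ρ ^ 3 ≤ ρ ^ 6 := pow_le_pow_right₀ hρ (by norm_num)
  have p4 : ρ ^ 4 ≤ ρ ^ 6 := pow_le_pow_right₀ hρ (by norm_num)
  calc _ = (quadCoeff a C f (ρ * κ) + ρ ^ 2 * (2 * κ ^ 2)) * y ^ 2
        + (quartCoeff a f (ρ * κ) + ρ * (κ / a)
          + 1 / (4 * a) * (quadCoeff a C f (ρ * κ) ^ 2 + ρ ^ 4 * (4 * κ ^ 4))) * y ^ 4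
        + (1 / (4 * a) * (quartCoeff a f (ρ * κ) ^ 2 + ρ ^ 2 * (κ ^ 2 / a ^ 2))) * y ^ 8 := by
        ring
    _ ≤ (ρ ^ 6 * α + ρ ^ 6 * (2 * κ ^ 2)) * y ^ 2
        + (ρ ^ 6 * γ + ρ ^ 6 * (κ / a)
          + 1 / (4 * a) * (ρ ^ 6 * α ^ 2 + ρ ^ 6 * (4 * κ ^ 4))) * y ^ 4
        + (1 / (4 * a) * (ρ ^ 6 * γ ^ 2 + ρ ^ 6 * (κ ^ 2 / a ^ 2))) * y ^ 8 := by
        have q1 : quadCoeff a C f (ρ * κ) ≤ ρ ^ 6 * α := hα'.trans (by gcongr)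
        have q2 : quartCoeff a f (ρ * κ) ≤ ρ ^ 6 * γ := hγ'.trans (by gcongr)
        have q3 : quadCoeff a C f (ρ * κ) ^ 2 ≤ ρ ^ 6 * α ^ 2 :=
          (pow_le_pow_left₀ hα'0 hα' 2).trans (le_of_eq (by ring))
        have q4 : quartCoeff a f (ρ * κ) ^ 2 ≤ ρ ^ 6 * γ ^ 2 :=
          (pow_le_pow_left₀ hγ'0 hγ' 2).trans (le_of_eq (by ring))
        have y8 : 0 ≤ y ^ 8 := by positivity
        have y4 : 0 ≤ y ^ 4 := by positivity
        gcongr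
    _ = (ρ * κ) ^ 6 * ((α + 2 * κ ^ 2) / κ ^ 6
          + (γ + κ / a + 1 / (4 * a) * (α ^ 2 + 4 * κ ^ 4)) / κ ^ 6 * y ^ 2
          + (1 / (4 * a) * (γ ^ 2 + κ ^ 2 / a ^ 2)) / κ ^ 6 * y ^ 6) * y ^ 2 := by
        field_simp
    _ ≤ _ := by
        have y6 : 0 ≤ y ^ 6 := by positivity
        gcongr

/-- Young's inequality in the form used throughout. -/
theorem mul_le_div_mul_sq_add {a s : ℝ} (ha : 0 < a) (hs : 0 < s) (u v : ℝ) :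
    u * v ≤ a / s * u ^ 2 + s / (4 * a) * v ^ 2 := by
  have : a / s * u ^ 2 + s / (4 * a) * v ^ 2 - u * v = (2 * a * u - s * v) ^ 2 / (4 * a * s) := by
    field_simp
    ring
  have : 0 ≤ (2 * a * u - s * v) ^ 2 / (4 * a * s) := by positivity
  linarith

/-- Since 1 ≤ bs + b(1/b - s)⁺, one multiplies by X and applies Young's inequality to the second
part. The resulting X² again has the factor bs, so the control can supply it. -/
theorem le_mul_add_of_gain {a s b X : ℝ} (ha : 0 < a) (hs : 0 < s) (hb : 0 < b) (hX : 0 ≤ X) :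
    X ≤ b * s * (X + 1 / (4 * a) * X ^ 2) + a / s * (b * max (1 / b - s) 0 ^ 2) := by
  set r := max (1 / b - s) 0
  have hr : 1 / b - s ≤ r := le_max_left _ _
  have h1 : 1 ≤ b * s + b * r := by
    have : b * (1 / b - s) ≤ b * r := by gcongr
    rw [mul_sub, mul_one_div_cancel hb.ne'] at this
    linarith
  have h2 := mul_le_div_mul_sq_add ha hs r X
  calc X = 1 * X := (one_mul X).symm
    _ ≤ (b * s + b * r) * X := by gcongr
    _ = b * s * X + b * (r * X) := by ring
    _ ≤ b * s * X + b * (a / s * r ^ 2 + s / (4 * a) * X ^ 2) := by gcongr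
    _ = _ := by ring

theorem g_eq (κ n l : ℝ) : g κ n l = max (n - (κ + Real.exp l)) 0 ^ 2 := by
  rw [g, sub_sub]

theorem g_nonneg (κ n l : ℝ) : 0 ≤ g κ n l := sq_nonneg _

/-- The gain inequality is applied to each dominated monomial separately, at the cost of one term b
g per monomial: two when y²/2 is estimated alone, four when the terms compensating the heat equation
are added. -/
theorem control_term_le {κ a C : ℝ} {φ P₁ P₂ P₃ : ℝ → ℝ}
    (hP : AdmissibleGains κ a C φ P₁ P₂ P₃) (hκ : 0 < κ) (ha : 0 < a) (hC : 0 < C)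
    (hφ : ∀ y, 0 ≤ φ y) {b : ℝ} (hb : 0 < b) (y z : ℝ) :
    y * (b * feedback κ P₁ P₂ P₃ z y)
      + (quadCoeff a C (φ y) (κ + Real.exp z) * y ^ 2
        + quartCoeff a (φ y) (κ + Real.exp z) * y ^ 4)
      ≤ a / (κ + Real.exp z) * (2 * (b * g κ (1 / b) z)) ∧
    y * (b * feedback κ P₁ P₂ P₃ z y)
      + (quadCoeff a C (φ y) (κ + Real.exp z) * y ^ 2
        + quartCoeff a (φ y) (κ + Real.exp z) * y ^ 4 + 2 * (κ + Real.exp z) ^ 2 * y ^ 2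
        + (κ + Real.exp z) / a * y ^ 4)
      ≤ a / (κ + Real.exp z) * (4 * (b * g κ (1 / b) z)) := by
  rw [g_eq, feedback]
  have hκs : κ ≤ κ + Real.exp z := by linarith [Real.exp_pos z]
  set s := κ + Real.exp z
  have hs : 0 < s := by linarith
  set X₁ := quadCoeff a C (φ y) s * y ^ 2
  set X₂ := quartCoeff a (φ y) s * y ^ 4
  set X₃ := 2 * s ^ 2 * y ^ 2
  set X₄ := s / a * y ^ 4
  have hX₁ : 0 ≤ X₁ := mul_nonneg (quadCoeff_nonneg ha hC (hφ y) hs) (by positivity)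
  have hX₂ : 0 ≤ X₂ := mul_nonneg (quartCoeff_nonneg ha hs) (by positivity)
  have hX₃ : 0 ≤ X₃ := by positivity
  have hX₄ : 0 ≤ X₄ := by positivity
  have h0 := mul_le_mul_of_nonneg_left (hP.dominates hκ ha hC hφ hκs y) (mul_pos hb hs).le
  have e : b * s * (s ^ 6 * (P₁ y + P₂ y * y ^ 2 + P₃ y * y ^ 6) * y ^ 2)
      = - (y * (b * -(s ^ 7 * (P₁ y + P₂ y * y ^ 2 + P₃ y * y ^ 6) * y))) := by ring
  rw [e] at h0
  have h1 := le_mul_add_of_gain ha hs hb hX₁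
  have h2 := le_mul_add_of_gain ha hs hb hX₂
  have h3 := le_mul_add_of_gain ha hs hb hX₃
  have h4 := le_mul_add_of_gain ha hs hb hX₄
  refine ⟨?_, by linarith⟩
  have h3' : 0 ≤ b * s * (X₃ + 1 / (4 * a) * X₃ ^ 2) := by positivity
  have h4' : 0 ≤ b * s * (X₄ + 1 / (4 * a) * X₄ ^ 2) := by positivity
  linarith

/-- The uncontrolled part of the `y`-equation. -/
theorem disturbance_term_le {a C s f y W n D : ℝ} (ha : 0 < a) (hs : 0 < s) (hf : 0 ≤ f)
    (hW : 0 ≤ W) :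
    |y| * (n * (W + f * |y|)) + |y| * D ≤
      quadCoeff a C f s * y ^ 2 + quartCoeff a f s * y ^ 4 - C * y ^ 2
      + a / (2 * s) * W ^ 2
      + a / s * (D ^ 2 + max (n - s) 0 ^ 2 + (max (n - s) 0 ^ 2) ^ 2) := by
  set r := max (n - s) 0
  have hn : n ≤ s + r := by linarith [le_max_left (n - s) 0]
  have y2 : |y| ^ 2 = y ^ 2 := sq_abs y
  have y4 : y ^ 4 = (|y| ^ 2) ^ 2 := by rw [y2]; ring
  set q := |y|
  have hq : 0 ≤ q := abs_nonneg y
  rw [y4, ← y2]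
  -- Young's inequality for every product left after n ≤ s + r, always with weight a/s. The estimate
  -- for r W q leaves r² (s/a) q², which needs a second application and produces the fourth power of
  -- r.
  have h1 := mul_le_div_mul_sq_add ha hs D q
  have h2 := mul_le_div_mul_sq_add ha hs (W / 2) (2 * s * q)
  have h3 := mul_le_div_mul_sq_add ha hs (W / 2) (2 * r * q)
  have h4 := mul_le_div_mul_sq_add ha hs (r ^ 2) (s / a * q ^ 2)
  have h5 := mul_le_div_mul_sq_add ha hs r (f * q ^ 2)
  have h6 : q * (n * (W + f * q)) ≤ q * ((s + r) * (W + f * q)) := by gcongr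
  have e2 : s / (4 * a) * (2 * s * q) ^ 2 = s ^ 3 / a * q ^ 2 := by field_simp; ring
  have e3 : s / (4 * a) * (2 * r * q) ^ 2 = r ^ 2 * (s / a * q ^ 2) := by field_simp; ring
  have e4 : s / (4 * a) * (s / a * q ^ 2) ^ 2 = s ^ 3 / (4 * a ^ 3) * (q ^ 2) ^ 2 := by
    field_simp
  have e5 : s / (4 * a) * (f * q ^ 2) ^ 2 = s * f ^ 2 / (4 * a) * (q ^ 2) ^ 2 := by
    field_simp
  have e6 : a / (2 * s) * W ^ 2 = 2 * (a / s * (W / 2) ^ 2) := by field_simp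
  rw [e2] at h2
  rw [e3] at h3
  rw [e4] at h4
  rw [e5] at h5
  rw [e6, quadCoeff, quartCoeff]
  linarith

/-- Treats the term (R‖θ₁‖)²y² inherited from the heat estimate, with n = R‖θ₁‖: n² ≤ 2s² + 2r² for
the excess r, then Young's inequality for r² · 2y². -/
theorem boundary_coupling_le {a s n y : ℝ} (ha : 0 < a) (hs : 0 < s) (hn : 0 ≤ n) :
    n ^ 2 * y ^ 2 ≤ 2 * s ^ 2 * y ^ 2 + s / a * y ^ 4 + a / s * (max (n - s) 0 ^ 2) ^ 2 := by
  set r := max (n - s) 0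
  have h0 : n ≤ s + r := by linarith [le_max_left (n - s) 0]
  have h1 : n ^ 2 ≤ 2 * s ^ 2 + 2 * r ^ 2 := by nlinarith [sq_nonneg (s - r)]
  have h2 := mul_le_div_mul_sq_add ha hs (r ^ 2) (2 * y ^ 2)
  have e2 : s / (4 * a) * (2 * y ^ 2) ^ 2 = s / a * y ^ 4 := by field_simp; ring
  rw [e2] at h2
  have h3 := mul_le_mul_of_nonneg_right h1 (sq_nonneg y)
  linarith

/-- The energy balance of the heat equation after the Poincaré inequality. -/
theorem heat_term_le {p W n D q G R : ℝ} (hR : R = 1 / p)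
    (hG : G = 1 / (p ^ 2 * (4 * Real.pi ^ 2 - 5))) :
    - (Real.pi ^ 2 * W ^ 2) + R * (W * (n * q)) + R * (W * D)
      ≤ - W ^ 2 + (R * n) ^ 2 * q ^ 2 + G * D ^ 2 := by
  have hc : 0 < 4 * Real.pi ^ 2 - 5 := by nlinarith [Real.pi_gt_three]
  have hG' : G = R ^ 2 / (4 * Real.pi ^ 2 - 5) := by
    rw [hG, hR, one_div_pow, div_div]
  set c := 4 * Real.pi ^ 2 - 5 with hcdef
  -- Budget for W²: of the available π², 1 is kept as dissipation, 1/4 pays for the coupling with y,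
  -- and the remaining c/4 = π² - 5/4 pays for D. This fixes G.
  have h1 : R * (W * D) ≤ G * D ^ 2 + c / 4 * W ^ 2 := by
    have : G * D ^ 2 + c / 4 * W ^ 2 - R * (W * D) = (2 * R * D - c * W) ^ 2 / (4 * c) := by
      rw [hG']; field_simp; ring
    have : 0 ≤ (2 * R * D - c * W) ^ 2 / (4 * c) := by positivity
    linarith
  have h2 := sq_nonneg (R * n * q - W / 2)
  nlinarith

/-! ### Differential inequalities along solutions -/

section ClosedLoop

variable {p : ℝ} {K : ℝ → ℝ → ℝ} {L : S → ℝ → ℝ} {φ P₁ P₂ P₃ d θ₂ b y z : ℝ → ℝ}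
  {ε Γ κ a C : ℝ} {θ₁ δ w : ℝ → L2}

theorem norm_le_of_ae_eq_mul {f θ : L2} {k : ℝ → ℝ} {q : ℝ}
    (hk : ∀ x ∈ Icc (0 : ℝ) 1, |k x| ≤ |q|)
    (hf : ∀ᵐ x ∂(volume.restrict (Ioo (0 : ℝ) 1)), f x = θ x * k x) :
    ‖f‖ ≤ ‖θ‖ * |q| := by
  have : ‖f‖ ≤ ‖q • θ‖ := by
    refine Lp.norm_le_norm_of_ae_le ?_
    filter_upwards [hf, Lp.coeFn_smul q θ, ae_restrict_mem measurableSet_Ioo] with x h1 h2 hx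
    rw [h1, h2, Pi.smul_apply, norm_mul, norm_smul, mul_comm]
    exact mul_le_mul_of_nonneg_right (hk x (Ioo_subset_Icc_self hx)) (norm_nonneg _)
  rwa [norm_smul, mul_comm] at this

theorem IsClosedLoopSolution.ae_deriv_norm_sq_le
    (hsol : IsClosedLoopSolution p K L ε Γ κ P₁ P₂ P₃ d θ₂ b θ₁ δ w y z) (hp : 0 < p)
    (hK : ∀ x ∈ Icc (0 : ℝ) 1, ∀ y : ℝ, |K x y| ≤ |y|) {R G : ℝ} (hR : R = 1 / p)
    (hG : G = 1 / (p ^ 2 * (4 * Real.pi ^ 2 - 5))) :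
    ∀ᵐ t ∂halfLine, ∃ f', HasDerivAt (fun t => ‖w t‖ ^ 2) f' t ∧
      1 / (2 * p) * f' ≤ -‖w t‖ ^ 2 + (R * ‖θ₁ t‖) ^ 2 * y t ^ 2 + G * ‖δ t‖ ^ 2 := by
  filter_upwards [hsol.heat, hsol.y_eq] with t ⟨wx, wxx, wt, hwx, hwxx, hwt, heq⟩ ⟨hS, _⟩
  refine ⟨_, hwt.norm_sq, ?_⟩
  have h1 := inner_weakDeriv_weakDeriv_le hS.2 hwx hwxx
  -- The reaction term is recovered as a residual in L², because K is not assumed measurable.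
  set f : L2 := wt - p • wxx - δ t with hf
  have hfn : ‖f‖ ≤ ‖θ₁ t‖ * |y t| := by
    refine norm_le_of_ae_eq_mul (k := fun x => K x (y t)) (fun x hx => hK x hx _) ?_
    filter_upwards [heq, Lp.coeFn_sub (wt - p • wxx) (δ t), Lp.coeFn_sub wt (p • wxx),
      Lp.coeFn_smul p wxx] with x e1 e2 e3 e4
    rw [hf, e2, Pi.sub_apply, e3, Pi.sub_apply, e4, Pi.smul_apply, smul_eq_mul, e1]
    ring
  have hwt' : wt = p • wxx + f + δ t := by rw [hf]; abel
  have h2 : inner ℝ (w t) f ≤ ‖w t‖ * (‖θ₁ t‖ * |y t|) :=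
    (real_inner_le_norm _ _).trans (by gcongr)
  have h3 : inner ℝ (w t) (δ t) ≤ ‖w t‖ * ‖δ t‖ := real_inner_le_norm _ _
  have hR0 : 0 < R := by rw [hR]; positivity
  have e : 1 / (2 * p) * (2 * inner ℝ (w t) wt)
      = inner ℝ (w t) wxx + R * inner ℝ (w t) f + R * inner ℝ (w t) (δ t) := by
    rw [hwt', inner_add_right, inner_add_right, real_inner_smul_right, hR]
    field_simp
  have h4 := heat_term_le (W := ‖w t‖) (n := ‖θ₁ t‖) (D := ‖δ t‖) (q := |y t|) hR hG
  rw [sq_abs] at h4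
  have h5 := mul_le_mul_of_nonneg_left h2 hR0.le
  have h6 := mul_le_mul_of_nonneg_left h3 hR0.le
  rw [e]
  linarith

theorem IsClosedLoopSolution.ae_deriv_sq_le
    (hsol : IsClosedLoopSolution p K L ε Γ κ P₁ P₂ P₃ d θ₂ b θ₁ δ w y z)
    (hL : ∀ (v : S) (y : ℝ), |L v y| ≤ ‖(v : L2)‖ + φ y * |y|) :
    ∀ᵐ t ∂halfLine, ∃ f', HasDerivAt (fun t => y t ^ 2 / 2) f' t ∧
      f' ≤ y t * (b t * feedback κ P₁ P₂ P₃ (z t) (y t))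
        + (|y t| * (|θ₂ t| * (‖w t‖ + φ (y t) * |y t|)) + |y t| * |d t|) := by
  filter_upwards [hsol.y_eq] with t ⟨hS, hy⟩
  have h := (hy.pow 2).div_const 2
  refine ⟨_, h, ?_⟩
  have h1 : y t * (θ₂ t * L ⟨w t, hS⟩ (y t)) ≤ |y t| * (|θ₂ t| * (‖w t‖ + φ (y t) * |y t|)) := by
    refine (le_abs_self _).trans ?_
    rw [abs_mul, abs_mul]
    gcongr
    exact hL ⟨w t, hS⟩ (y t)
  have h2 : y t * d t ≤ |y t| * |d t| := (le_abs_self _).trans (abs_mul _ _).le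
  have e : ((2 : ℕ) : ℝ) * y t ^ (2 - 1) * (b t * feedback κ P₁ P₂ P₃ (z t) (y t)
      + θ₂ t * L ⟨w t, hS⟩ (y t) + d t) / 2
      = y t * (b t * feedback κ P₁ P₂ P₃ (z t) (y t)) + y t * (θ₂ t * L ⟨w t, hS⟩ (y t))
        + y t * d t := by
    norm_num; ring
  rw [e]
  linarith

/-- All the forcing, including the contribution of ‖w‖², carries the factor a/(κ + exp z). This
attenuation is what keeps the gain bounded. -/
theorem IsClosedLoopSolution.ae_deriv_half_sq_le
    (hsol : IsClosedLoopSolution p K L ε Γ κ P₁ P₂ P₃ d θ₂ b θ₁ δ w y z)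
    (hφ : ∀ y, 0 ≤ φ y) (hL : ∀ (v : S) (y : ℝ), |L v y| ≤ ‖(v : L2)‖ + φ y * |y|)
    (hκ : 0 < κ) (ha : 0 < a) (hC : 0 < C) (hP : AdmissibleGains κ a C φ P₁ P₂ P₃)
    (hb : ∀ᵐ t ∂halfLine, 0 < b t) :
    ∀ᵐ t ∂halfLine, ∃ f', HasDerivAt (fun t => y t ^ 2 / 2) f' t ∧
      f' ≤ -C * y t ^ 2 + a / (κ + Real.exp (z t)) * (1 / 2 * ‖w t‖ ^ 2
        + (|d t| ^ 2 + g κ |θ₂ t| (z t) + g κ |θ₂ t| (z t) ^ 2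
          + 2 * (b t * g κ (1 / b t) (z t)))) := by
  filter_upwards [hsol.ae_deriv_sq_le hL, hb] with t ⟨f', hf', hle⟩ hbt
  refine ⟨f', hf', hle.trans ?_⟩
  have hs : 0 < κ + Real.exp (z t) := by positivity
  have h1 := (control_term_le hP hκ ha hC hφ hbt (y t) (z t)).1
  have h2 := disturbance_term_le (C := C) (y := y t) (n := |θ₂ t|) (D := |d t|) ha hs
    (hφ (y t)) (norm_nonneg (w t))
  rw [← g_eq] at h2
  have e : a / (2 * (κ + Real.exp (z t))) * ‖w t‖ ^ 2
      = a / (κ + Real.exp (z t)) * (1 / 2 * ‖w t‖ ^ 2) := by field_simp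
  linarith

/-- The forcing is kept at the current values of the inputs and of the gain: bounding these
uniformly gives the exponential estimate, and passing to the limit gives the final alternative. -/
theorem IsClosedLoopSolution.ae_deriv_lyapunov_le
    (hsol : IsClosedLoopSolution p K L ε Γ κ P₁ P₂ P₃ d θ₂ b θ₁ δ w y z) (hp : 0 < p)
    (hK : ∀ x ∈ Icc (0 : ℝ) 1, ∀ y : ℝ, |K x y| ≤ |y|)
    (hφ : ∀ y, 0 ≤ φ y) (hL : ∀ (v : S) (y : ℝ), |L v y| ≤ ‖(v : L2)‖ + φ y * |y|)
    (hκ : 0 < κ) (ha : 0 < a) (hC : 0 < C) (hP : AdmissibleGains κ a C φ P₁ P₂ P₃)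
    (hb : ∀ᵐ t ∂halfLine, 0 < b t) {R G K₂ μ : ℝ} (hR : R = 1 / p)
    (hG : G = 1 / (p ^ 2 * (4 * Real.pi ^ 2 - 5))) (hK₂ : K₂ = 1 / (2 * p))
    (hμ : μ = rate K₂ κ a C) :
    ∀ᵐ t ∂halfLine, ∃ f', HasDerivAt (fun t => K₂ * ‖w t‖ ^ 2 + y t ^ 2 / 2) f' t ∧
      f' ≤ -μ * (K₂ * ‖w t‖ ^ 2 + y t ^ 2 / 2)
        + constZ G R κ a ‖δ t‖ |d t| ‖θ₁ t‖ |θ₂ t| (b t) (z t) := by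
  filter_upwards [hsol.ae_deriv_norm_sq_le hp hK hR hG, hsol.ae_deriv_sq_le hL, hb]
    with t ⟨f₁, hf₁, hle₁⟩ ⟨f₂, hf₂, hle₂⟩ hbt
  refine ⟨_, (hf₁.const_mul K₂).add hf₂, ?_⟩
  have hK₂0 : 0 < K₂ := by rw [hK₂]; positivity
  have hs : 0 < κ + Real.exp (z t) := by positivity
  have hR0 : 0 < R := by rw [hR]; positivity
  have h1 := (control_term_le hP hκ ha hC hφ hbt (y t) (z t)).2
  have h2 := disturbance_term_le (C := C) (y := y t) (n := |θ₂ t|) (D := |d t|) ha hs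
    (hφ (y t)) (norm_nonneg (w t))
  have h3 := boundary_coupling_le (y := y t) ha hs (mul_nonneg hR0.le (norm_nonneg (θ₁ t)))
  rw [← g_eq] at h2 h3
  rw [← hK₂] at hle₁
  -- The dissipation -‖w‖² must also absorb a/(2s)‖w‖² ≤ a/(2κ)‖w‖² coming from the y-equation; the
  -- first entry of the minimum defining μ is what remains.
  have m1 : μ * K₂ ≤ 1 - a / (2 * κ) := by
    have : μ ≤ (2 * κ - a) / (2 * κ * K₂) := hμ ▸ min_le_left _ _
    calc μ * K₂ ≤ (2 * κ - a) / (2 * κ * K₂) * K₂ := by gcongr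
      _ = _ := by field_simp
  have m2 : μ / 2 ≤ C := by
    have : μ ≤ 2 * C := hμ ▸ min_le_right _ _
    linarith
  have m3 : a / (2 * (κ + Real.exp (z t))) ≤ a / (2 * κ) := by
    gcongr
    linarith [Real.exp_pos (z t)]
  have n1 := mul_le_mul_of_nonneg_right m1 (sq_nonneg ‖w t‖)
  have n2 := mul_le_mul_of_nonneg_right m2 (sq_nonneg (y t))
  have n3 := mul_le_mul_of_nonneg_right m3 (sq_nonneg ‖w t‖)
  rw [constZ]
  linarith

theorem g_mono {n n' z₀ z₁ : ℝ} (hn : n' ≤ n) (hz : z₀ ≤ z₁) : g κ n' z₁ ≤ g κ n z₀ := by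
  unfold g
  gcongr

/-- With s = κ + exp z₀, the quantity β g(1/β) equals (1 - βs)⁺(1/β - s)⁺, a product of two
nonnegative nonincreasing functions of β. -/
theorem mul_g_one_div_mono {β β' z₀ z₁ : ℝ} (hκ : 0 < κ) (hβ : 0 < β) (hβ' : β ≤ β')
    (hz : z₀ ≤ z₁) : β' * g κ (1 / β') z₁ ≤ β * g κ (1 / β) z₀ := by
  have hβ'0 : 0 < β' := hβ.trans_le hβ'
  calc β' * g κ (1 / β') z₁ ≤ β' * g κ (1 / β') z₀ := by
        gcongr
        exact g_mono le_rfl hz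
    _ ≤ β * g κ (1 / β) z₀ := by
        rw [g_eq, g_eq]
        have hs : 0 < κ + Real.exp z₀ := by positivity
        set s := κ + Real.exp z₀
        have e : ∀ c : ℝ, 0 < c → c * max (1 / c - s) 0 = max (1 - c * s) 0 := fun c hc => by
          rw [mul_max_of_nonneg _ _ hc.le, mul_zero, mul_sub, mul_one_div_cancel hc.ne']
        calc β' * max (1 / β' - s) 0 ^ 2 = (β' * max (1 / β' - s) 0) * max (1 / β' - s) 0 := by
              ring
          _ ≤ (β * max (1 / β - s) 0) * max (1 / β - s) 0 := by
              rw [e β' hβ'0, e β hβ]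
              gcongr
          _ = _ := by ring

theorem constZ_mono {G R nδ nδ' nd nd' n₁ n₁' n₂ n₂' β β' z₀ z₁ : ℝ} (hκ : 0 < κ) (ha : 0 < a)
    (hG : 0 ≤ G) (hR : 0 ≤ R) (hz : z₀ ≤ z₁) (hβ : 0 < β) (hβ' : β ≤ β')
    (hδ0 : 0 ≤ nδ') (hδ : nδ' ≤ nδ) (hd0 : 0 ≤ nd') (hd : nd' ≤ nd) (h₁ : n₁' ≤ n₁)
    (h₂ : n₂' ≤ n₂) :
    constZ G R κ a nδ' nd' n₁' n₂' β' z₁ ≤ constZ G R κ a nδ nd n₁ n₂ β z₀ := by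
  have g₂ := g_mono (κ := κ) h₂ hz
  have g₁ := g_mono (κ := κ) (mul_le_mul_of_nonneg_left h₁ hR) hz
  have gb := mul_g_one_div_mono hκ hβ hβ' hz
  have hs : 0 < κ + Real.exp z₀ := by positivity
  have p₂ := g_nonneg κ n₂' z₁
  have p₁ := g_nonneg κ (R * n₁') z₁
  have pb : 0 ≤ β' * g κ (1 / β') z₁ := mul_nonneg (hβ.trans_le hβ').le (g_nonneg _ _ _)
  unfold constZ
  rw [mul_assoc 4 β', mul_assoc 4 β]
  gcongr

theorem constZ_nonneg {G R nδ nd n₁ n₂ β z₀ : ℝ} (hκ : 0 < κ) (ha : 0 < a) (hG : 0 ≤ G)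
    (hβ : 0 < β) : 0 ≤ constZ G R κ a nδ nd n₁ n₂ β z₀ := by
  have p₂ := g_nonneg κ n₂ z₀
  have p₁ := g_nonneg κ (R * n₁) z₀
  have pb := g_nonneg κ (1 / β) z₀
  unfold constZ
  positivity

theorem MemLinf.ae_norm_le {E : Type*} [NormedAddCommGroup E] {f : ℝ → E} (hf : MemLinf f) :
    ∀ᵐ t ∂halfLine, ‖f t‖ ≤ normInf f := by
  have htop : eLpNorm f ⊤ halfLine ≠ ⊤ := hf.2.ne
  filter_upwards [ae_le_eLpNormEssSup (f := f) (μ := halfLine)] with t ht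
  rw [← eLpNorm_exponent_top] at ht
  rw [← toReal_enorm]
  exact ENNReal.toReal_mono htop ht

end ClosedLoop

/-! ### The adaptation dynamics -/

section Adaptation

variable {v ζ : ℝ → ℝ} {C M Γ ε : ℝ}

theorem LocAC.le_of_ae_deriv_nonneg {f : ℝ → ℝ} (hf : LocAC f)
    (h : ∀ᵐ t ∂halfLine, ∃ f', HasDerivAt f f' t ∧ 0 ≤ f') {s t : ℝ} (hs : 0 ≤ s)
    (hst : s ≤ t) : f s ≤ f t := by
  have := (hf.mono hs hst).fun_neg.le_of_ae_deriv_nonpos hst (by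
    filter_upwards [ae_halfLine_iff.1 h] with x hx hxm
    obtain ⟨f', h1, h2⟩ := hx (hs.trans hxm.1.le)
    exact ⟨-f', h1.neg, by linarith⟩)
  linarith

/-- The transient bound for a gain `ζ` driven by the excess of `v` over `ε`, when the forcing of
`v` is attenuated by the gain. -/
theorem gain_le (hv : LocAC v) (hζ : LocAC ζ) (hv0 : ∀ t, 0 ≤ v t)
    (hζm : ∀ s t, 0 ≤ s → s ≤ t → ζ s ≤ ζ t) (hζ0 : 0 < ζ 0) (hC : 0 < C) (hΓ : 0 < Γ)
    (hε : 0 < ε) (hM : 0 ≤ M)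
    (hdv : ∀ᵐ t ∂halfLine, ∃ f', HasDerivAt v f' t ∧ f' ≤ -(2 * C) * v t + M / (1 + ζ t))
    (hdζ : ∀ᵐ t ∂halfLine, HasDerivAt ζ (Γ * max (v t - ε) 0) t) {t : ℝ} (ht : 0 ≤ t) :
    ζ t ≤ ζ 0 + Γ / (2 * C) * (v 0 + M / (2 * C * (1 + ζ 0))) + M / (2 * C * ε) := by
  -- Once the gain is at least r, the forcing M/(1 + ζ) is at most 2Cε, so ε becomes the asymptotic
  -- level for v. If ζ never exceeds the larger of ζ 0 and r there is nothing to prove; otherwise t₁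
  -- below is a time at which it equals that level.
  set r := M / (2 * C * ε) with hr
  set v₁ := v 0 + M / (2 * C * (1 + ζ 0)) with hv₁
  have hr0 : 0 ≤ r := by positivity
  have hv₁0 : 0 ≤ v₁ := add_nonneg (hv0 0) (by positivity)
  have hp : 0 ≤ Γ / (2 * C) * v₁ := by positivity
  by_cases hcase : ζ t ≤ max (ζ 0) r
  · have : max (ζ 0) r ≤ ζ 0 + r := max_le (by linarith) (by linarith)
    linarith
  push Not at hcase
  have hcont : ContinuousOn ζ (Icc 0 t) := by
    have := (hζ.mono le_rfl ht).continuousOn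
    rwa [uIcc_of_le ht] at this
  obtain ⟨t₁, ⟨ht₁0, ht₁t⟩, ht₁⟩ :=
    intermediate_value_Icc ht hcont ⟨le_max_left (ζ 0) r, hcase.le⟩
  have hvt₁ : v t₁ ≤ v₁ := by
    have h := (hv.mono le_rfl ht₁0).le_exp_of_ae_deriv_le (c := 2 * C) (M := M / (1 + ζ 0))
      ht₁0 (by positivity) (by
        filter_upwards [ae_halfLine_iff.1 hdv] with x hx hxm
        obtain ⟨f', h1, h2⟩ := hx hxm.1.le
        refine ⟨f', h1, h2.trans ?_⟩
        have := hζm 0 x le_rfl hxm.1.le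
        gcongr)
    have e : M / (1 + ζ 0) / (2 * C) = M / (2 * C * (1 + ζ 0)) := by
      rw [div_div, mul_comm]
    rw [e] at h
    have hE : Real.exp (-(2 * C) * (t₁ - 0)) ≤ 1 := by
      rw [Real.exp_le_one_iff]; nlinarith
    have hq : 0 ≤ M / (2 * C * (1 + ζ 0)) := by positivity
    have : Real.exp (-(2 * C) * (t₁ - 0)) * (v 0 - M / (2 * C * (1 + ζ 0))) ≤ v 0 := by
      nlinarith [Real.exp_pos (-(2 * C) * (t₁ - 0)), hv0 0, mul_nonneg
        (Real.exp_pos (-(2 * C) * (t₁ - 0))).le hq]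
    linarith
  have hexc : ∀ x, t₁ ≤ x → max (v x - ε) 0 ≤ Real.exp (-(2 * C) * (x - t₁)) * v₁ := by
    intro x hx
    have h := (hv.mono ht₁0 hx).le_exp_of_ae_deriv_le (c := 2 * C) (M := 2 * C * ε)
      hx (by positivity) (by
        filter_upwards [ae_halfLine_iff.1 hdv] with x' hx' hxm
        obtain ⟨f', h1, h2⟩ := hx' (ht₁0.trans hxm.1.le)
        refine ⟨f', h1, h2.trans ?_⟩
        have h3 := hζm t₁ x' ht₁0 hxm.1.le
        have h4 : r ≤ ζ x' := (le_max_right (ζ 0) r).trans (ht₁ ▸ h3)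
        have h5 : M / (1 + ζ x') ≤ 2 * C * ε := by
          rw [div_le_iff₀ (by linarith)]
          calc M = 2 * C * ε * r := by rw [hr]; field_simp
            _ ≤ 2 * C * ε * (1 + ζ x') := by gcongr; linarith
        linarith)
    have e : 2 * C * ε / (2 * C) = ε := by field_simp
    rw [e] at h
    refine max_le (h.trans ?_) (by positivity)
    gcongr
    linarith
  -- The added exponential is the integral from x to infinity of the bound on ζ', so the sum is
  -- nonincreasing; comparing its values at t₁ and t bounds the remaining growth of ζ by Γ v₁/(2C).
  have hac : AbsolutelyContinuousOnInterval
      (fun x => ζ x + Γ / (2 * C) * v₁ * Real.exp (-(2 * C) * (x - t₁))) t₁ t := by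
    have h1 : ContDiff ℝ 1 (fun x => Γ / (2 * C) * v₁ * Real.exp (-(2 * C) * (x - t₁))) := by
      fun_prop
    exact (hζ.mono ht₁0 ht₁t).fun_add (h1.absolutelyContinuousOnInterval _ _)
  have key := hac.le_of_ae_deriv_nonpos ht₁t (by
    filter_upwards [ae_halfLine_iff.1 hdζ] with x hx hxm
    have hd : HasDerivAt (fun x => Real.exp (-(2 * C) * (x - t₁)))
        (Real.exp (-(2 * C) * (x - t₁)) * (-(2 * C))) x := by
      simpa using (((hasDerivAt_id x).sub_const t₁).const_mul (-(2 * C))).exp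
    refine ⟨_, (hx (ht₁0.trans hxm.1.le)).add (hd.const_mul (Γ / (2 * C) * v₁)), ?_⟩
    have e : Γ / (2 * C) * v₁ * (Real.exp (-(2 * C) * (x - t₁)) * (-(2 * C)))
        = - (Γ * (Real.exp (-(2 * C) * (x - t₁)) * v₁)) := by field_simp
    rw [e]
    have := mul_le_mul_of_nonneg_left (hexc x hxm.1.le) hΓ.le
    linarith)
  simp only [sub_self, mul_zero, Real.exp_zero, mul_one] at key
  have hpos : 0 ≤ Γ / (2 * C) * v₁ * Real.exp (-(2 * C) * (t - t₁)) := by positivity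
  have hmax : max (ζ 0) r ≤ ζ 0 + r := max_le (by linarith) (by linarith)
  linarith

theorem exists_tendsto_of_monotone_of_le {f : ℝ → ℝ} (hm : ∀ s t, 0 ≤ s → s ≤ t → f s ≤ f t)
    {B : ℝ} (hB : ∀ t, 0 ≤ t → f t ≤ B) :
    ∃ l, Tendsto f atTop (𝓝 l) := by
  have hmono : Monotone (fun t => f (max t 0)) := fun s t hst =>
    hm _ _ (le_max_right _ _) (max_le_max_right 0 hst)
  have hbdd : BddAbove (range fun t => f (max t 0)) :=
    ⟨B, by rintro _ ⟨t, rfl⟩; exact hB _ (le_max_right _ _)⟩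
  refine ⟨⨆ t, f (max t 0), (tendsto_atTop_ciSup hmono hbdd).congr' ?_⟩
  filter_upwards [eventually_ge_atTop 0] with t ht
  rw [max_eq_left ht]

/-- A one-sided Barbalat lemma: the excess of `v` over `ε` vanishes in the limit when its
integral converges and the growth rate of `v` is bounded. -/
theorem eventually_le_of_gain_tendsto (hv : LocAC v) (hζ : LocAC ζ) (hΓ : 0 < Γ) {l : ℝ}
    (hl : Tendsto ζ atTop (𝓝 l)) (hM : 0 ≤ M)
    (hdv : ∀ᵐ t ∂halfLine, ∃ f', HasDerivAt v f' t ∧ f' ≤ M)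
    (hdζ : ∀ᵐ t ∂halfLine, HasDerivAt ζ (Γ * max (v t - ε) 0) t) {r : ℝ} (hr : 0 < r) :
    ∀ᶠ t in atTop, v t ≤ ε + r := by
  -- Window length: if v exceeds ε + r at t, the growth bound M keeps it above ε + r/2 on [t - τ,
  -- t], so ζ gains at least Γ(r/2)τ there, against its convergence. The summand 1 covers M = 0.
  set τ := r / 2 / (M + 1)
  have hτ : 0 < τ := by positivity
  have hMτ : M * τ ≤ r / 2 := by
    calc M * τ ≤ (M + 1) * τ := by gcongr; linarith
      _ = r / 2 := by simp only [τ]; field_simp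
  have hdiff : Tendsto (fun t => ζ t - ζ (t - τ)) atTop (𝓝 0) := by
    have := hl.sub (hl.comp (tendsto_atTop_add_const_right atTop (-τ) tendsto_id))
    simpa [sub_eq_add_neg] using this
  have hc : 0 < Γ * (r / 2) * τ := by positivity
  filter_upwards [hdiff.eventually_lt_const hc, eventually_ge_atTop τ] with t h1 htτ
  by_contra! hlt
  have hs0 : 0 ≤ t - τ := by linarith
  have hlow : ∀ x, t - τ ≤ x → x ≤ t → ε + r / 2 ≤ v x := by
    intro x hx1 hx2
    have hlin : ContDiff ℝ 1 (fun x : ℝ => M * x) := by fun_prop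
    have h := ((hv.mono (hs0.trans hx1) hx2).fun_sub
      (hlin.absolutelyContinuousOnInterval x t)).le_of_ae_deriv_nonpos hx2 (by
        filter_upwards [ae_halfLine_iff.1 hdv] with x' hx' hxm
        obtain ⟨f', h2, h3⟩ := hx' ((hs0.trans hx1).trans hxm.1.le)
        refine ⟨f' - M, h2.sub ?_, by linarith⟩
        simpa using (hasDerivAt_id x').const_mul M)
    have : M * (t - x) ≤ M * τ := by gcongr; linarith
    linarith
  have hlin : ContDiff ℝ 1 (fun x : ℝ => Γ * (r / 2) * x) := by fun_prop
  have h := ((hlin.absolutelyContinuousOnInterval (t - τ) t).fun_sub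
    (hζ.mono hs0 (by linarith))).le_of_ae_deriv_nonpos (by linarith) (by
      filter_upwards [ae_halfLine_iff.1 hdζ] with x hx hxm
      have hd : HasDerivAt (fun x : ℝ => Γ * (r / 2) * x) (Γ * (r / 2)) x := by
        simpa using (hasDerivAt_id x).const_mul (Γ * (r / 2))
      refine ⟨_, hd.sub (hx (hs0.trans hxm.1.le)), ?_⟩
      have h2 := hlow x hxm.1.le hxm.2.le
      have h3 : r / 2 ≤ max (v x - ε) 0 := le_max_of_le_left (by linarith)
      have := mul_le_mul_of_nonneg_left h3 hΓ.le
      linarith)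
  linarith

end Adaptation

/-! ### Upper limits of the inputs -/

section Limits

variable {κ : ℝ}

theorem MemLinf.isBoundedUnder {E : Type*} [NormedAddCommGroup E] {f : ℝ → E} (hf : MemLinf f) :
    IsBoundedUnder (· ≤ ·) atTopAE (fun t => ‖f t‖) :=
  ⟨normInf f, eventually_map.2 (eventually_atTopAE_of_halfLine hf.ae_norm_le)⟩

theorem limsup_le_of_forall_lt {u : ℝ → ℝ} {m : ℝ} (hu : ∀ t, 0 ≤ u t)
    (h : ∀ c, m < c → ∀ᶠ t in atTop, u t ≤ c) : limsup u atTop ≤ m :=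
  le_of_forall_gt_imp_ge_of_dense fun c hc =>
    limsup_le_of_le (IsBoundedUnder.isCoboundedUnder_le
      ⟨0, eventually_map.2 (Eventually.of_forall hu)⟩) (h c hc)

theorem le_sqrt_of_sq_le {x c : ℝ} (hc : 0 ≤ c) (h : x ^ 2 ≤ c ^ 2) : x ≤ c :=
  (abs_le_of_sq_le_sq' h hc).2

/-- If `s` has the limit `l` and the upper limit of `u` is at most `l`, then `(u - s)⁺ → 0`. -/
theorem tendsto_max_sub_zero {F : Filter ℝ} {u s : ℝ → ℝ} {l : ℝ} (hs : Tendsto s F (𝓝 l))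
    (hu : ∀ r, 0 < r → ∀ᶠ t in F, u t ≤ l + r) :
    Tendsto (fun t => max (u t - s t) 0) F (𝓝 0) := by
  refine tendsto_order.2 ⟨fun c hc => Eventually.of_forall fun t =>
    hc.trans_le (le_max_right _ _), fun c hc => ?_⟩
  filter_upwards [hu (c / 4) (by positivity), hs.eventually (lt_mem_nhds
    (show l - c / 4 < l by linarith))] with t h1 h2
  exact max_lt (by linarith) hc

theorem tendsto_g_zero {F : Filter ℝ} {u z : ℝ → ℝ} {l : ℝ} (hz : Tendsto z F (𝓝 l))
    (hu : ∀ r, 0 < r → ∀ᶠ t in F, u t ≤ κ + Real.exp l + r) :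
    Tendsto (fun t => g κ (u t) (z t)) F (𝓝 0) := by
  have hs : Tendsto (fun t => κ + Real.exp (z t)) F (𝓝 (κ + Real.exp l)) :=
    ((Real.continuous_exp.tendsto l).comp hz).const_add κ
  simp only [g_eq]
  simpa using (tendsto_max_sub_zero hs hu).pow 2

/-- Without disturbances, the forcing of the Lyapunov estimate vanishes in the limit as soon as the
final gain is at least the upper limit of the uncertain inputs. -/
theorem tendsto_constZ_zero {p G R a zlim : ℝ} {d θ₂ b z : ℝ → ℝ} {θ₁ δ : ℝ → L2} (hp : 0 < p)
    (hκ : 0 < κ) (hR : R = 1 / p) (hθ₁ : MemLinf θ₁) (hθ₂ : MemLinf θ₂)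
    (hb_pos : ∀ᵐ t ∂halfLine, 0 < b t) (hzm : ∀ s t, 0 ≤ s → s ≤ t → z s ≤ z t)
    (hzlim : Tendsto z atTop (𝓝 zlim)) (hd0 : Tendsto d atTopAE (𝓝 0))
    (hδ0 : Tendsto δ atTopAE (𝓝 0)) (hbl : 1 / κ ≤ liminf b atTopAE)
    (hnot : limsup (fun t => max (p⁻¹ * ‖θ₁ t‖) |θ₂ t|) atTopAE ≤ κ + Real.exp zlim) :
    Tendsto (fun t => constZ G R κ a ‖δ t‖ |d t| ‖θ₁ t‖ |θ₂ t| (b t) (z t)) atTopAE (𝓝 0) := by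
  have hpos : ∀ᵐ t ∂halfLine, 0 ≤ t := ae_restrict_mem measurableSet_Ici
  have hzAE : Tendsto z atTopAE (𝓝 zlim) := hzlim.mono_left inf_le_left
  have hinput : ∀ r, 0 < r → ∀ᶠ t in atTopAE,
      max (p⁻¹ * ‖θ₁ t‖) |θ₂ t| ≤ κ + Real.exp zlim + r := by
    intro r hr
    have hbd : IsBoundedUnder (· ≤ ·) atTopAE (fun t => max (p⁻¹ * ‖θ₁ t‖) |θ₂ t|) := by
      refine ⟨max (p⁻¹ * normInf θ₁) (normInf θ₂), eventually_map.2 ?_⟩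
      filter_upwards [eventually_atTopAE_of_halfLine hθ₁.ae_norm_le,
        eventually_atTopAE_of_halfLine hθ₂.ae_norm_le] with t h1 h2
      have hp' : 0 ≤ p⁻¹ := by positivity
      exact max_le_max (mul_le_mul_of_nonneg_left h1 hp') h2
    exact (eventually_lt_of_limsup_lt (lt_of_le_of_lt hnot (by linarith)) hbd).mono
      fun _ h => h.le
  have g₂ := tendsto_g_zero (κ := κ) hzAE fun r hr =>
    (hinput r hr).mono fun t ht => (le_max_right _ _).trans ht
  have g₁ := tendsto_g_zero (κ := κ) (u := fun t => R * ‖θ₁ t‖) hzAE fun r hr =>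
    (hinput r hr).mono fun t ht => by
      rw [hR, one_div]
      exact (le_max_left _ _).trans ht
  have gb : Tendsto (fun t => 4 * b t * g κ (1 / b t) (z t)) atTopAE (𝓝 0) := by
    have hs₀ : 0 < κ + Real.exp (z 0) := by positivity
    -- Since exp(z 0) > 0 the inequality is strict, so eventually 1/b lies below the gain and the
    -- deficit is exactly zero; otherwise a limit would need an upper bound on b.
    have h1 : 1 / (κ + Real.exp (z 0)) < liminf b atTopAE :=
      lt_of_lt_of_le (one_div_lt_one_div_of_lt hκ (by linarith [Real.exp_pos (z 0)])) hbl
    have h2 := eventually_lt_of_lt_liminf h1 ⟨0, eventually_map.2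
      ((eventually_atTopAE_of_halfLine hb_pos).mono fun _ h => h.le)⟩
    refine tendsto_const_nhds.congr' ?_
    filter_upwards [h2, eventually_atTopAE_of_halfLine hpos] with t h3 ht
    have h4 : 1 / b t < κ + Real.exp (z 0) :=
      (one_div_lt hs₀ ((one_div_pos.2 hs₀).trans h3)).1 h3
    have h5 := Real.exp_le_exp.2 (hzm 0 t le_rfl ht)
    rw [g_eq, max_eq_right (by linarith)]
    ring
  have hs : Tendsto (fun t => a / (κ + Real.exp (z t))) atTopAE
      (𝓝 (a / (κ + Real.exp zlim))) :=
    tendsto_const_nhds.div (((Real.continuous_exp.tendsto zlim).comp hzAE).const_add κ)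
      (by positivity)
  have := ((hδ0.norm.pow 2).const_mul G).add
    (hs.mul (((hd0.abs.pow 2).add g₂).add (g₂.pow 2))) |>.add (hs.mul (gb.add (g₁.pow 2)))
  simpa [constZ] using this

/-- The upper limit of the plant state when `y²/2` is eventually close to `[0, ε]`. -/
theorem IsClosedLoopSolution.limsup_norm_le {p ε Γ : ℝ} {K : ℝ → ℝ → ℝ} {L : S → ℝ → ℝ}
    {P₁ P₂ P₃ d θ₂ b y z : ℝ → ℝ} {θ₁ δ w : ℝ → L2}
    (hsol : IsClosedLoopSolution p K L ε Γ κ P₁ P₂ P₃ d θ₂ b θ₁ δ w y z) (hp : 0 < p)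
    (hK : ∀ x ∈ Icc (0 : ℝ) 1, ∀ y : ℝ, |K x y| ≤ |y|) {R G : ℝ} (hR : R = 1 / p)
    (hG : G = 1 / (p ^ 2 * (4 * Real.pi ^ 2 - 5))) (hθ₁ : MemLinf θ₁) (hδ : MemLinf δ)
    (hybar : ∀ r, 0 < r → ∀ᶠ t in atTop, y t ^ 2 / 2 ≤ ε + r) :
    limsup (fun t => ‖w t‖) atTop ≤
      Real.sqrt (2 * ε * R ^ 2 * (limsup (fun t => ‖θ₁ t‖) atTopAE) ^ 2
        + G * (limsup (fun t => ‖δ t‖) atTopAE) ^ 2) := by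
  have hR0 : 0 < R := by rw [hR]; positivity
  have hG0 : 0 < G := by
    have hc : 0 < 4 * Real.pi ^ 2 - 5 := by nlinarith [Real.pi_gt_three]
    rw [hG]; positivity
  set ℓ₁ := limsup (fun t => ‖θ₁ t‖) atTopAE
  set ℓδ := limsup (fun t => ‖δ t‖) atTopAE
  refine limsup_le_of_forall_lt (fun _ => norm_nonneg _) fun c hc => ?_
  have hc0 : 0 < c := (Real.sqrt_nonneg _).trans_lt hc
  rw [Real.sqrt_lt' hc0] at hc
  -- A single slack r serves for both upper limits, for y²/2 and for the differential inequality. By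
  -- continuity of m at 0, some r > 0 already gives a value below c².
  set m : ℝ → ℝ := fun r =>
    (R * (ℓ₁ + r)) ^ 2 * (2 * (ε + r)) + G * (ℓδ + r) ^ 2 + 2 * p * r with hm
  have hmc : Continuous m := by fun_prop
  have hm0 : m 0 < c ^ 2 := by
    refine lt_of_eq_of_lt ?_ hc
    simp only [hm]
    ring
  obtain ⟨r, hrc, hr⟩ := ((hmc.continuousAt.eventually (gt_mem_nhds hm0)).filter_mono
    nhdsWithin_le_nhds |>.and (self_mem_nhdsWithin (s := Ioi (0 : ℝ)))).exists
  have hr0 : 0 < r := hr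
  have hle := LocAC.eventually_le_of_ae_deriv_le (f := fun t => 1 / (2 * p) * ‖w t‖ ^ 2)
    (h := fun t => (R * ‖θ₁ t‖) ^ 2 * y t ^ 2 + G * ‖δ t‖ ^ 2) (c := 2 * p)
    (M := (R * (ℓ₁ + r)) ^ 2 * (2 * (ε + r)) + G * (ℓδ + r) ^ 2)
    (hsol.w_ac.const_mul _) (by positivity) (by
      filter_upwards [hsol.ae_deriv_norm_sq_le hp hK hR hG] with t ⟨f', h1, h2⟩
      refine ⟨_, h1.const_mul _, h2.trans (le_of_eq ?_)⟩
      field_simp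
      ring) (by
      filter_upwards [eventually_lt_of_limsup_lt (show ℓ₁ < ℓ₁ + r by linarith)
        hθ₁.isBoundedUnder, eventually_lt_of_limsup_lt (show ℓδ < ℓδ + r by linarith)
        hδ.isBoundedUnder, eventually_atTopAE_of_atTop (hybar r hr0)] with t h1 h2 h3
      have h4 : y t ^ 2 ≤ 2 * (ε + r) := by linarith
      gcongr) hr0
  filter_upwards [hle] with t ht
  refine le_sqrt_of_sq_le hc0.le ?_
  have h1 : ‖w t‖ ^ 2 = 2 * p * (1 / (2 * p) * ‖w t‖ ^ 2) := by field_simp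
  have h2 := mul_le_mul_of_nonneg_left ht (show (0 : ℝ) ≤ 2 * p by positivity)
  rw [mul_add, mul_div_cancel₀ _ (by positivity)] at h2
  rw [h1]
  exact h2.trans hrc.le

end Limits

end DADS

/-! ### Assembly of the estimates -/

set_option maxHeartbeats 400000 in
theorem corollary2
    -- the unknown plant
    (p : ℝ) (hp : 0 < p)
    (K : ℝ → ℝ → ℝ) (L : S → ℝ → ℝ)
    (φ : ℝ → ℝ) (hφ : ContDiff ℝ ∞ φ) (hφ_nonneg : ∀ y, 0 ≤ φ y)
    (hL : ∀ (v : S) (y : ℝ), |L v y| ≤ ‖(v : L2)‖ + φ y * |y|)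
    (hK : ∀ x ∈ Icc (0 : ℝ) 1, ∀ y : ℝ, |K x y| ≤ |y|)
    -- the controller
    (ε Γ κ a C : ℝ) (hε : 0 < ε) (hΓ : 0 < Γ) (hκ : 0 < κ) (ha : 0 < a) (hC : 0 < C)
    (hκa : a < 2 * κ)
    (P₁ P₂ P₃ : ℝ → ℝ) (hP : AdmissibleGains κ a C φ P₁ P₂ P₃)
    -- the inputs
    (d θ₂ b : ℝ → ℝ) (θ₁ δ : ℝ → L2)
    (hd : MemLinf d) (hθ₁ : MemLinf θ₁) (hθ₂ : MemLinf θ₂) (hδ : MemLinf δ) (hb : MemLinf b)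
    (hb_pos : ∀ᵐ t ∂halfLine, 0 < b t) (hb_inf : 0 < essInf b halfLine)
    -- the solution
    (w : ℝ → L2) (y z : ℝ → ℝ)
    (hsol : IsClosedLoopSolution p K L ε Γ κ P₁ P₂ P₃ d θ₂ b θ₁ δ w y z)
    -- the constants of the estimates
    (K₁ K₂ R G μ Z B : ℝ)
    (hK₁ : K₁ = 1 / (2 * p)) (hK₂ : K₂ = 1 / (2 * p)) (hR : R = 1 / p)
    (hG : G = 1 / (p ^ 2 * (4 * Real.pi ^ 2 - 5)))
    (hμ : μ = rate K₂ κ a C)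
    (hZ : Z = constZ G R κ a (normInf δ) (normInf d) (normInf θ₁) (normInf θ₂)
      (essInf b halfLine) (z 0))
    (hB : B = constB K₁ K₂ κ μ Z ‖w 0‖ (y 0) (normInf d) (normInf θ₂)
      (essInf b halfLine) (z 0)) :
    (∀ t : ℝ, 0 ≤ t →
      2 * K₁ * ‖w t‖ ^ 2 + |y t| ^ 2 ≤
        Real.exp (-μ * t) * (2 * K₂ * ‖w 0‖ ^ 2 + |y 0| ^ 2) + 2 * μ⁻¹ * Z) ∧
    (∀ t : ℝ, 0 ≤ t →
      z 0 ≤ z t ∧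
      z t ≤ Real.log (Real.exp (z 0) + Γ / (4 * C) * |y 0| ^ 2
        + a * B * ((2 * C * (1 + Real.exp (z 0)) + ε * Γ)
          / (4 * C ^ 2 * ε * min 1 κ * (1 + Real.exp (z 0)))))) ∧
    limsup (fun t => ‖w t‖) atTop ≤
      Real.sqrt (K₂ / K₁ * (2 * ε * R ^ 2 * (limsup (fun t => ‖θ₁ t‖) atTopAE) ^ 2
        + G * (limsup (fun t => ‖δ t‖) atTopAE) ^ 2)) ∧
    limsup (fun t => |y t|) atTop ≤ Real.sqrt (2 * ε) ∧
    ∃ zlim : ℝ, Tendsto z atTop (𝓝 zlim) ∧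
      (Tendsto d atTopAE (𝓝 0) → Tendsto δ atTopAE (𝓝 0) → 1 / κ ≤ liminf b atTopAE →
        (Tendsto (fun t => |y t|) atTop (𝓝 0) ∧ Tendsto (fun t => ‖w t‖) atTop (𝓝 0)) ∨
        κ + Real.exp zlim < limsup (fun t => max (p⁻¹ * ‖θ₁ t‖) |θ₂ t|) atTopAE) := by
  have hK₁0 : 0 < K₁ := by rw [hK₁]; positivity
  have hKK : K₁ = K₂ := by rw [hK₁, hK₂]
  have hK₂0 : 0 < K₂ := hKK ▸ hK₁0
  have hR0 : 0 < R := by rw [hR]; positivity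
  have hG0 : 0 < G := by
    have hc : 0 < 4 * Real.pi ^ 2 - 5 := by nlinarith [Real.pi_gt_three]
    rw [hG]; positivity
  have hμ0 : 0 < μ := by
    have : 0 < 2 * κ - a := by linarith
    rw [hμ, rate]
    exact lt_min (by positivity) (by positivity)
  set β := essInf b halfLine
  have hβ : ∀ᵐ t ∂halfLine, β ≤ b t :=
    ae_essInf_le ⟨0, eventually_map.2 (hb_pos.mono fun _ h => h.le)⟩
  have hZ0 : 0 ≤ Z := hZ ▸ constZ_nonneg hκ ha hG0.le hb_inf
  have hpos : ∀ᵐ t ∂halfLine, 0 ≤ t := ae_restrict_mem measurableSet_Ici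
  -- monotonicity of the gain
  have hzAC : LocAC z := LocAC.of_contDiffOn hsol.z_C1
  have hzm : ∀ s t, 0 ≤ s → s ≤ t → z s ≤ z t := fun s t hs hst =>
    hzAC.le_of_ae_deriv_nonneg (hsol.z_eq.mono fun t ht => ⟨_, ht, by
      unfold updateLaw
      exact mul_nonneg (mul_nonneg hΓ.le (Real.exp_pos _).le) (le_max_right _ _)⟩) hs hst
  have hyAC : LocAC (fun t => y t ^ 2 / 2) := by
    simpa [div_eq_inv_mul] using hsol.y_ac.sq.const_mul (1 / 2)
  have hVAC : LocAC (fun t => K₂ * ‖w t‖ ^ 2 + y t ^ 2 / 2) := (hsol.w_ac.const_mul K₂).add hyAC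
  have hlyap := hsol.ae_deriv_lyapunov_le hp hK hφ_nonneg hL hκ ha hC hP hb_pos hR hG hK₂ hμ
  -- the exponential estimate
  have hV : ∀ t, 0 ≤ t → K₂ * ‖w t‖ ^ 2 + y t ^ 2 / 2
      ≤ Real.exp (-μ * t) * (K₂ * ‖w 0‖ ^ 2 + y 0 ^ 2 / 2) + μ⁻¹ * Z := by
    intro t ht
    have h := (hVAC.mono le_rfl ht).le_exp_of_ae_deriv_le ht hμ0 (M := Z) (by
      filter_upwards [ae_halfLine_iff.1 hlyap, ae_halfLine_iff.1 hβ,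
        ae_halfLine_iff.1 hd.ae_norm_le, ae_halfLine_iff.1 hδ.ae_norm_le,
        ae_halfLine_iff.1 hθ₁.ae_norm_le, ae_halfLine_iff.1 hθ₂.ae_norm_le]
        with x h1 h2 h3 h4 h5 h6 hx
      have hx0 := hx.1.le
      obtain ⟨f', hf', hle⟩ := h1 hx0
      refine ⟨f', hf', hle.trans ?_⟩
      have := constZ_mono hκ ha hG0.le hR0.le (hzm 0 x le_rfl hx0) hb_inf (h2 hx0)
        (norm_nonneg _) (h4 hx0) (abs_nonneg _) (h3 hx0) (h5 hx0) (h6 hx0)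
      rw [Real.norm_eq_abs] at this
      rw [hZ]
      linarith)
    rw [sub_zero] at h
    have hq : 0 ≤ Real.exp (-μ * t) * (Z / μ) := by positivity
    have e : Z / μ = μ⁻¹ * Z := by ring
    linarith
  -- the adapted gain
  set ζ := fun t => Real.exp (z t) with hζdef
  have hζAC : LocAC ζ := LocAC.of_contDiffOn hsol.z_C1.exp
  have hζd : ∀ᵐ t ∂halfLine, HasDerivAt ζ (Γ * max (y t ^ 2 / 2 - ε) 0) t := by
    filter_upwards [hsol.z_eq] with t ht
    convert! ht.exp using 1
    rw [updateLaw, Real.exp_neg]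
    field_simp
  have hζm : ∀ s t, 0 ≤ s → s ≤ t → ζ s ≤ ζ t := fun s t hs hst =>
    Real.exp_le_exp.2 (hzm s t hs hst)
  -- As min(1, κ)(1 + ζ) ≤ κ + ζ, the forcing aB/(κ + ζ) is at most M/(1 + ζ), the form required by
  -- `gain_le`.
  set M := a * B / min 1 κ with hMdef
  have hmin : 0 < min 1 κ := lt_min one_pos hκ
  have hB0 : 0 ≤ B := by
    have p₂ := g_nonneg κ (normInf θ₂) (z 0)
    have pb := g_nonneg κ (1 / β) (z 0)
    rw [hB, constB]
    positivity
  have hM0 : 0 ≤ M := by positivity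
  have hyd : ∀ᵐ t ∂halfLine, ∃ f', HasDerivAt (fun t => y t ^ 2 / 2) f' t ∧
      f' ≤ -(2 * C) * (y t ^ 2 / 2) + M / (1 + ζ t) := by
    filter_upwards [hsol.ae_deriv_half_sq_le hφ_nonneg hL hκ ha hC hP hb_pos, hβ,
      hd.ae_norm_le, hθ₂.ae_norm_le, hpos] with t ⟨f', hf', hle⟩ h2 h3 h6 ht
    refine ⟨f', hf', hle.trans ?_⟩
    have hz0 := hzm 0 t le_rfl ht
    have g₂ : g κ |θ₂ t| (z t) ≤ g κ (normInf θ₂) (z 0) := g_mono h6 hz0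
    have g₂0 := g_nonneg κ |θ₂ t| (z t)
    have gb := mul_g_one_div_mono hκ hb_inf h2 hz0
    have hdt : |d t| ^ 2 ≤ normInf d ^ 2 := pow_le_pow_left₀ (abs_nonneg _) h3 2
    have g₂s := pow_le_pow_left₀ g₂0 g₂ 2
    have hE : Real.exp (-μ * t) ≤ 1 := by
      rw [Real.exp_le_one_iff]; nlinarith
    have hV0 : 0 ≤ K₂ * ‖w 0‖ ^ 2 + y 0 ^ 2 / 2 := by positivity
    -- The exponential estimate is fed back here: it bounds ‖w‖ uniformly in time by initial data
    -- and Z, which gives the first summand of B.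
    have hw : 1 / 2 * ‖w t‖ ^ 2
        ≤ 1 / (2 * K₁) * (K₂ * ‖w 0‖ ^ 2 + 1 / 2 * |y 0| ^ 2 + μ⁻¹ * Z) := by
      have h1 := hV t ht
      have h7 := mul_le_mul_of_nonneg_right hE hV0
      have h8 : K₂ * ‖w t‖ ^ 2 ≤ K₂ * ‖w 0‖ ^ 2 + 1 / 2 * |y 0| ^ 2 + μ⁻¹ * Z := by
        rw [sq_abs]
        linarith [sq_nonneg (y t)]
      calc 1 / 2 * ‖w t‖ ^ 2 = 1 / (2 * K₁) * (K₂ * ‖w t‖ ^ 2) := by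
            rw [hKK]; field_simp
        _ ≤ _ := by gcongr
    have hsum : 1 / 2 * ‖w t‖ ^ 2 + (|d t| ^ 2 + g κ |θ₂ t| (z t) + g κ |θ₂ t| (z t) ^ 2
        + 2 * (b t * g κ (1 / b t) (z t))) ≤ B := by
      rw [hB, constB]
      linarith
    have hs : min 1 κ * (1 + ζ t) ≤ κ + Real.exp (z t) := by
      have e1 : min 1 κ * 1 ≤ κ := by rw [mul_one]; exact min_le_right _ _
      have e2 : min 1 κ * ζ t ≤ 1 * ζ t := by
        gcongr
        exact min_le_left _ _
      rw [mul_add]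
      simp only [hζdef] at e2 ⊢
      linarith
    have hζt : 0 < ζ t := Real.exp_pos _
    have h9 : a / (κ + Real.exp (z t)) * (1 / 2 * ‖w t‖ ^ 2 + (|d t| ^ 2 + g κ |θ₂ t| (z t)
        + g κ |θ₂ t| (z t) ^ 2 + 2 * (b t * g κ (1 / b t) (z t)))) ≤ M / (1 + ζ t) := by
      calc _ ≤ a / (κ + Real.exp (z t)) * B := by gcongr
        _ = a * B / (κ + Real.exp (z t)) := by ring
        _ ≤ a * B / (min 1 κ * (1 + ζ t)) := by gcongr
        _ = M / (1 + ζ t) := by rw [hMdef, div_div]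
    linarith
  have hζ0 : 0 < ζ 0 := Real.exp_pos _
  have hζle : ∀ t, 0 ≤ t → ζ t ≤ Real.exp (z 0) + Γ / (4 * C) * |y 0| ^ 2
        + a * B * ((2 * C * (1 + Real.exp (z 0)) + ε * Γ)
          / (4 * C ^ 2 * ε * min 1 κ * (1 + Real.exp (z 0)))) := by
    intro t ht
    refine (gain_le hyAC hζAC (fun t => by positivity) hζm hζ0 hC hΓ hε hM0 hyd hζd ht).trans
      (le_of_eq ?_)
    rw [sq_abs, hMdef]
    change Real.exp (z 0) + Γ / (2 * C) * (y 0 ^ 2 / 2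
      + a * B / min 1 κ / (2 * C * (1 + Real.exp (z 0)))) + a * B / min 1 κ / (2 * C * ε) = _
    have : 0 < 1 + Real.exp (z 0) := by positivity
    field_simp
    ring
  have hzle : ∀ t, 0 ≤ t → z t ≤ Real.log (Real.exp (z 0) + Γ / (4 * C) * |y 0| ^ 2
        + a * B * ((2 * C * (1 + Real.exp (z 0)) + ε * Γ)
          / (4 * C ^ 2 * ε * min 1 κ * (1 + Real.exp (z 0))))) := fun t ht =>
    (Real.le_log_iff_exp_le ((Real.exp_pos _).trans_le (hζle t ht))).2 (hζle t ht)
  obtain ⟨zlim, hzlim⟩ := exists_tendsto_of_monotone_of_le hzm hzle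
  -- the upper limit of `y`
  have hybar : ∀ r, 0 < r → ∀ᶠ t in atTop, y t ^ 2 / 2 ≤ ε + r := fun r hr =>
    eventually_le_of_gain_tendsto hyAC hζAC hΓ ((Real.continuous_exp.tendsto zlim).comp hzlim)
      hM0 (by
        filter_upwards [hyd] with t ⟨f', h1, h2⟩
        refine ⟨f', h1, h2.trans ?_⟩
        have h3 : M / (1 + ζ t) ≤ M :=
          div_le_self hM0 (by have : 0 < ζ t := Real.exp_pos _
                              linarith)
        nlinarith [sq_nonneg (y t)]) hζd hr
  refine ⟨fun t ht => ?_, fun t ht => ⟨hzm 0 t le_rfl ht, hzle t ht⟩, ?_, ?_, zlim, hzlim, ?_⟩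
  · have := hV t ht
    rw [sq_abs, sq_abs, hKK]
    linarith
  · rw [hKK, div_self hK₂0.ne', one_mul]
    exact hsol.limsup_norm_le hp hK hR hG hθ₁ hδ hybar
  · refine limsup_le_of_forall_lt (fun _ => abs_nonneg _) fun c hc => ?_
    have hc0 : 0 < c := (Real.sqrt_nonneg _).trans_lt hc
    rw [Real.sqrt_lt' hc0] at hc
    filter_upwards [hybar (c ^ 2 / 2 - ε) (by linarith)] with t ht
    refine le_sqrt_of_sq_le hc0.le ?_
    rw [sq_abs]
    linarith
  · -- the alternative in the absence of disturbances
    intro hd0 hδ0 hbl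
    -- Negating the second alternative says that the limiting gain is at least the upper limit of
    -- the inputs, which makes the Lyapunov forcing vanish in the limit.
    refine or_iff_not_imp_right.2 fun hnot => ?_
    rw [not_lt] at hnot
    have hh := tendsto_constZ_zero (a := a) (G := G) hp hκ hR hθ₁ hθ₂ hb_pos hzm hzlim hd0 hδ0
      hbl hnot
    have hVlim : ∀ r, 0 < r → ∀ᶠ t in atTop, K₂ * ‖w t‖ ^ 2 + y t ^ 2 / 2 ≤ r := by
      intro r hr
      have := hVAC.eventually_le_of_ae_deriv_le hμ0 hlyap (M := μ * (r / 2))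
        ((hh.eventually (gt_mem_nhds (by positivity))).mono fun _ h => h.le)
        (r := r / 2) (by positivity)
      filter_upwards [this] with t ht
      rw [mul_div_cancel_left₀ _ hμ0.ne'] at ht
      linarith
    have tend : ∀ (u : ℝ → ℝ) (k : ℝ), 0 < k → (∀ t, 0 ≤ u t) →
        (∀ t, k * u t ^ 2 ≤ K₂ * ‖w t‖ ^ 2 + y t ^ 2 / 2) → Tendsto u atTop (𝓝 0) := by
      intro u k hk hu hle
      refine tendsto_order.2 ⟨fun c hc => Eventually.of_forall fun t => hc.trans_le (hu t),
        fun c hc => ?_⟩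
      filter_upwards [hVlim (k * (c / 2) ^ 2) (by positivity)] with t ht
      have h1 : u t ^ 2 ≤ (c / 2) ^ 2 := le_of_mul_le_mul_left ((hle t).trans ht) hk
      have := le_sqrt_of_sq_le (by positivity) h1
      linarith
    refine ⟨tend _ (1 / 2) (by norm_num) (fun _ => abs_nonneg _) fun t => ?_,
      tend _ K₂ hK₂0 (fun _ => norm_nonneg _) fun t => ?_⟩
    · rw [sq_abs]
      have : 0 ≤ K₂ * ‖w t‖ ^ 2 := by positivity
      linarith
    · linarith [sq_nonneg (y t)]
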